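/- For $j\in\{1,3\}$ and real $x$ let $B_j(x)$ denote the number of positive integers $n\le x$ that can be written as $n=X^2+jY^2$ with integers $X,Y$. Let $$C_{b_1}=\frac{1}{\sqrt 2}\prod_{p\equiv 3\,(\mathrm{mod}\,4)}\left(1-p^{-2}\right)^{-1/2},\qquad C_{b_3}=\frac{1}{\sqrt 2}\,\frac{1}{3^{1/4}}\prod_{p\equiv 2\,(\mathrm{mod}\,3)}\left(1-p^{-2}\right)^{-1/2},$$ where $p$ runs over primes. a) For every real $x\ge 2$, $$\left|B_1(x)-C_{b_1}\frac{x}{\sqrt{\log x}}\right|\le 9.62\,\frac{x}{\log x}.$$ b) For every real $x\ge 2$, $$\left|B_3(x)-C_{b_3}\frac{x}{\sqrt{\log x}}\right|\le 8.53\,\frac{x}{\log x}.$$ -/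

import Mathlib

namespace LandauRamanujan

open Classical in
/-- The characteristic function `b_j` of the natural numbers represented by the quadratic form
`X ^ 2 + j * Y ^ 2` with integers `X` and `Y`. -/
noncomputable def b (j n : ℕ) : ℝ :=
  if ∃ X Y : ℤ, (n : ℤ) = X ^ 2 + (j : ℤ) * Y ^ 2 then 1 else 0

/-- `B_j(x)`, the sum of `b_j(n)` over the positive integers `n ≤ x`. -/
noncomputable def B (j : ℕ) (x : ℝ) : ℝ :=
  ∑ n ∈ Finset.Icc 1 ⌊x⌋₊, b j n

/-- The primes congruent to `a` modulo `q` (used with `a < q`). -/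
abbrev PrimesMod (q a : ℕ) : Type := {p : ℕ // p.Prime ∧ p % q = a}

/-- The Landau-Ramanujan constant
`C_{b_1} = 2 ^ (-1/2) * ∏_{p ≡ 3 mod 4} (1 - p ^ (-2)) ^ (-1/2)`. -/
noncomputable def C₁ : ℝ :=
  1 / √2 * ∏' p : PrimesMod 4 3, (1 - 1 / (p : ℝ) ^ 2) ^ (-(1 / 2) : ℝ)

/-- Its analogue for `X ^ 2 + 3 * Y ^ 2`:
`C_{b_3} = 2 ^ (-1/2) * 3 ^ (-1/4) * ∏_{p ≡ 2 mod 3} (1 - p ^ (-2)) ^ (-1/2)`. -/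
noncomputable def C₃ : ℝ :=
  1 / √2 * (1 / (3 : ℝ) ^ (1 / 4 : ℝ)) *
    ∏' p : PrimesMod 3 2, (1 - 1 / (p : ℝ) ^ 2) ^ (-(1 / 2) : ℝ)

/-- The infinite products in `C₁` and `C₃` converge, so that `∏'` is their actual value. -/
theorem multipliable_factor (q a : ℕ) :
    Multipliable fun p : PrimesMod q a => (1 - 1 / (p : ℝ) ^ 2) ^ (-(1 / 2) : ℝ) := by
  have hs : Summable fun p : PrimesMod q a => 1 / (p : ℝ) ^ 2 :=
    (Real.summable_one_div_nat_pow.mpr one_lt_two).comp_injective Subtype.val_injective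
  have hpos : ∀ p : PrimesMod q a, (0 : ℝ) < 1 - 1 / (p : ℝ) ^ 2 := by
    intro p
    have h2 : (2 : ℝ) ≤ (p : ℝ) := by exact_mod_cast p.2.1.two_le
    rw [sub_pos, div_lt_one (by positivity)]
    nlinarith
  have hl : Summable fun p : PrimesMod q a => Real.log (1 - 1 / (p : ℝ) ^ 2) := by
    simpa [sub_eq_add_neg] using Real.summable_log_one_add_of_summable hs.neg
  refine Real.multipliable_of_summable_log (fun p => Real.rpow_pos_of_pos (hpos p) _) ?_
  simpa only [Real.log_rpow (hpos _)] using hl.mul_left (-(1 / 2) : ℝ)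

end LandauRamanujan

namespace LandauRamanujan

open Finset ArithmeticFunction Filter Topology MeasureTheory
open scoped ArithmeticFunction.zeta ArithmeticFunction.Moebius

/-! Take `q = 4` for `j = 1` and `q = 3` for `j = 3`. A positive integer is represented exactly when
every prime `≡ -1 mod q` divides it to an even power, so `b j` agrees with the multiplicative
function `evenInd q` on positive integers (`b_one_eq`, `b_three_eq`). Its Dirichlet series `F`
satisfies `F² = ζ L(χ) G`, where `G`, the series of `sqQuot q`, is supported on numbers `r^a k²`
with `r` the prime dividing `q`, and converges at `s = 1`.

Write `B(x) = ∑ b(n)` and `H(x) = ∑ b(n)/n` over `n ≤ x`. Logarithmic differentiation of `F²`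
becomes the convolution identity `two_mul_evenInd_pmul_log` for `2 b log`. Its part `lam * b` sums
to `O(x)`, because `∑ lam(n)/n` is bounded. In the other part `log m` is compared with `y/m`: in
`∑_{m ≤ y} reps(m) (log m - y/m)` the terms `ρ y log y` cancel, leaving `-c y` and a small error
(`exists_kernel_bound`), while the terms `y/m`, convolved with `oneModInv q`, reassemble exactly to
`x H(x)`. Hence `2 B(x) log x - x H(x) + B(x)` is `O(x)`, and after division by `x` it lies in an
explicit interval `[m, M]` of length `17.06` (`exists_mem_interval`).

Put `f(u) = H(e^u) - e^{-u} B(e^u)`. It is continuous with right derivative `e^{-u} B(e^u)`, so the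
previous statement reads `m ≤ 2 u f' - f ≤ M`. Then `(f + M)/√u` decreases and `(f + m)/√u`
increases, which forces `f = A √u + O(1)` (`exists_sqrt_asymptotic`). Inserting this in the
inequality gives `B(x) = (A/2) x/√(log x)` with error at most `(M - m)/2 = 8.53` times `x / log x`
(`exists_asymptotic`).

The constant comes from an Abelian argument: `√δ F(1+δ)` tends to `A √π / 2`, while `δ ζ(1+δ) L(1+δ,
χ)` tends to `L(1, χ)`. Comparing squares gives `A² π / 4 = L(1, χ) G(1)` (`sq_mul_pi_eq`), and the
Euler product of `G` with `L(1, χ) = π/4` or `π/(3√3)` yields the stated products. All this concerns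
`x ≥ e^12.5`; smaller `x` follow from crude bounds on `B` and on the constant. -/

/-- For `q = 3, 4`, the nonprincipal Dirichlet character modulo `q`. -/
noncomputable def chi (q : ℕ) : ArithmeticFunction ℝ :=
  ⟨fun n => if n = 0 then 0 else if n % q = 1 then 1 else if n % q = q - 1 then -1 else 0, by simp⟩

open Classical in
/-- The indicator function of the positive integers all of whose prime factors are `1` modulo
`q`. -/
noncomputable def oneMod (q : ℕ) : ArithmeticFunction ℝ :=
  ⟨fun n => if n ≠ 0 ∧ ∀ p, p.Prime → p ∣ n → p % q = 1 then 1 else 0, by simp⟩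

/-- The convolution inverse of `oneMod q`. -/
noncomputable def oneModInv (q : ℕ) : ArithmeticFunction ℝ :=
  (oneMod q).pmul (μ : ArithmeticFunction ℝ)

/-- The divisor sum of the character, with Dirichlet series `ζ(s) L(s, χ)`. -/
noncomputable def reps (q : ℕ) : ArithmeticFunction ℝ := (ζ : ArithmeticFunction ℝ) * chi q

/-- The indicator function of the integers in which every prime `≡ -1` modulo `q` has an even
exponent (see `evenInd_eq`). -/
noncomputable def evenInd (q : ℕ) : ArithmeticFunction ℝ := reps q * oneModInv q

/-- The quotient of the convolution square of `evenInd q` by `reps q`. -/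
noncomputable def sqQuot (q : ℕ) : ArithmeticFunction ℝ := evenInd q * oneModInv q

/-- The logarithmic derivative of `sqQuot q`. -/
noncomputable def lam (q : ℕ) : ArithmeticFunction ℝ :=
  ((ζ : ArithmeticFunction ℝ) + chi q - 2 * oneMod q).pmul vonMangoldt

/-! ### Convolution identities and values at prime powers -/

section CompletelyMultiplicative

variable {R : Type*} [CommRing R]

theorem pmul_mul_distrib {f : ArithmeticFunction R} (hf : ∀ m n, f (m * n) = f m * f n)
    (g h : ArithmeticFunction R) : f.pmul (g * h) = f.pmul g * f.pmul h := by
  ext n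
  simp only [pmul_apply, mul_apply, mul_sum]
  refine sum_congr rfl fun x hx => ?_
  rw [← (Nat.mem_divisorsAntidiagonal.1 hx).1, hf]
  ring

theorem isMultiplicative_of_map_mul {f : ArithmeticFunction R} (h1 : f 1 = 1)
    (hf : ∀ m n, f (m * n) = f m * f n) : f.IsMultiplicative :=
  ⟨h1, fun {_ _} _ => hf _ _⟩

/-- Multiplication by `log` is a derivation for Dirichlet convolution, because `log (ab) = log a +
log b`. -/
theorem log_pmul_mul (f g : ArithmeticFunction ℝ) :
    (f * g).pmul log = f.pmul log * g + f * g.pmul log := by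
  ext n
  simp only [pmul_apply, ArithmeticFunction.add_apply, mul_apply, sum_mul, ← sum_add_distrib]
  refine sum_congr rfl fun x hx => ?_
  obtain ⟨h1, h2⟩ := Nat.mem_divisorsAntidiagonal.1 hx
  have hx1 : (x.1 : ℝ) ≠ 0 := by
    rintro h
    simp only [Nat.cast_eq_zero] at h
    simp [h] at h1
    exact h2 h1.symm
  have hx2 : (x.2 : ℝ) ≠ 0 := by
    rintro h
    simp only [Nat.cast_eq_zero] at h
    simp [h] at h1
    exact h2 h1.symm
  rw [log_apply, log_apply, log_apply, ← h1, Nat.cast_mul, Real.log_mul hx1 hx2]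
  ring

theorem mul_apply_prime_pow (f g : ArithmeticFunction R) {p : ℕ} (hp : p.Prime) (k : ℕ) :
    (f * g) (p ^ k) = ∑ j ∈ range (k + 1), f (p ^ j) * g (p ^ (k - j)) := by
  rw [mul_apply, Nat.sum_divisorsAntidiagonal (fun a b => f a * g b), Nat.divisors_prime_pow hp,
    sum_map]
  refine sum_congr rfl fun j hj => ?_
  rw [mem_range] at hj
  simp only [Function.Embedding.coeFn_mk]
  rw [Nat.pow_div (by omega) hp.pos]

theorem map_mem_unitInterval {f : ArithmeticFunction ℝ} (hf : f.IsMultiplicative)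
    (h : ∀ p k : ℕ, p.Prime → 0 ≤ f (p ^ k) ∧ f (p ^ k) ≤ 1) (n : ℕ) : 0 ≤ f n ∧ f n ≤ 1 := by
  rcases eq_or_ne n 0 with rfl | hn
  · simp
  · rw [hf.multiplicative_factorization f hn]
    have hp : ∀ p ∈ n.factorization.support, p.Prime := fun p hp =>
      Nat.prime_of_mem_primeFactors (by simpa using hp)
    exact ⟨prod_nonneg fun p h' => (h p _ (hp p h')).1,
      prod_le_one (fun p h' => (h p _ (hp p h')).1) fun p h' => (h p _ (hp p h')).2⟩

end CompletelyMultiplicative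

theorem chi_apply {q n : ℕ} (hn : n ≠ 0) :
    chi q n = if n % q = 1 then 1 else if n % q = q - 1 then -1 else 0 := if_neg hn

theorem chi_one {q : ℕ} (hq : q = 3 ∨ q = 4) : chi q 1 = 1 := by
  rcases hq with rfl | rfl <;> simp [chi_apply]

theorem chi_mul {q : ℕ} (hq : q = 3 ∨ q = 4) (m n : ℕ) : chi q (m * n) = chi q m * chi q n := by
  rcases eq_or_ne m 0 with rfl | hm
  · simp
  rcases eq_or_ne n 0 with rfl | hn
  · simp
  rw [chi_apply hm, chi_apply hn, chi_apply (mul_ne_zero hm hn), Nat.mul_mod]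
  rcases hq with rfl | rfl
  · have h1 := Nat.mod_lt m (show 3 > 0 by norm_num)
    have h2 := Nat.mod_lt n (show 3 > 0 by norm_num)
    generalize m % 3 = a at *
    generalize n % 3 = c at *
    interval_cases a <;> interval_cases c <;> norm_num
  · have h1 := Nat.mod_lt m (show 4 > 0 by norm_num)
    have h2 := Nat.mod_lt n (show 4 > 0 by norm_num)
    generalize m % 4 = a at *
    generalize n % 4 = c at *
    interval_cases a <;> interval_cases c <;> norm_num

theorem chi_pow {q : ℕ} (hq : q = 3 ∨ q = 4) (n k : ℕ) : chi q (n ^ k) = chi q n ^ k := by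
  induction k with
  | zero => simp [chi_one hq]
  | succ k ih => rw [pow_succ, chi_mul hq, ih, pow_succ]

theorem oneMod_mul (q m n : ℕ) : oneMod q (m * n) = oneMod q m * oneMod q n := by
  classical
  simp only [oneMod, coe_mk, ite_zero_mul_ite_zero, mul_one]
  refine if_congr ?_ rfl rfl
  constructor
  · rintro ⟨h0, h⟩
    exact ⟨⟨left_ne_zero_of_mul h0, fun p hp hd => h p hp (hd.mul_right _)⟩,
      right_ne_zero_of_mul h0, fun p hp hd => h p hp (hd.mul_left _)⟩
  · rintro ⟨⟨h1, h2⟩, h3, h4⟩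
    exact ⟨mul_ne_zero h1 h3, fun p hp hd => (hp.dvd_mul.1 hd).elim (h2 p hp) (h4 p hp)⟩

theorem oneMod_one (q : ℕ) : oneMod q 1 = 1 := by
  simp only [oneMod, coe_mk]
  refine if_pos ⟨one_ne_zero, fun p hp hd => ?_⟩
  exact absurd (Nat.dvd_one.1 hd) hp.one_lt.ne'

theorem oneMod_prime (q : ℕ) {p : ℕ} (hp : p.Prime) :
    oneMod q p = if p % q = 1 then 1 else 0 := by
  classical
  simp only [oneMod, coe_mk]
  refine if_congr ⟨fun h => h.2 p hp dvd_rfl, fun h => ⟨hp.ne_zero, fun r hr hd => ?_⟩⟩ rfl rfl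
  rwa [(Nat.prime_dvd_prime_iff_eq hr hp).1 hd]

theorem oneMod_pow (q n k : ℕ) : oneMod q (n ^ k) = oneMod q n ^ k := by
  induction k with
  | zero => simp [oneMod_one]
  | succ k ih => rw [pow_succ, oneMod_mul, ih, pow_succ]

theorem oneMod_mul_oneModInv (q : ℕ) : oneMod q * oneModInv q = 1 := by
  have h := pmul_mul_distrib (oneMod_mul q) (ζ : ArithmeticFunction ℝ) (μ : ArithmeticFunction ℝ)
  rw [coe_zeta_mul_coe_moebius, pmul_zeta] at h
  rw [oneModInv, ← h]
  ext n
  rw [pmul_apply, one_apply]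
  split_ifs with hn
  · rw [hn, oneMod_one, one_mul]
  · rw [mul_zero]

theorem isMultiplicative_reps {q : ℕ} (hq : q = 3 ∨ q = 4) : (reps q).IsMultiplicative :=
  isMultiplicative_zeta.natCast.mul (isMultiplicative_of_map_mul (chi_one hq) (chi_mul hq))

theorem isMultiplicative_oneModInv (q : ℕ) : (oneModInv q).IsMultiplicative :=
  (isMultiplicative_of_map_mul (oneMod_one q) (oneMod_mul q)).pmul isMultiplicative_moebius.intCast

theorem isMultiplicative_evenInd {q : ℕ} (hq : q = 3 ∨ q = 4) : (evenInd q).IsMultiplicative :=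
  (isMultiplicative_reps hq).mul (isMultiplicative_oneModInv q)

theorem isMultiplicative_sqQuot {q : ℕ} (hq : q = 3 ∨ q = 4) : (sqQuot q).IsMultiplicative :=
  (isMultiplicative_evenInd hq).mul (isMultiplicative_oneModInv q)

theorem evenInd_mul_self (q : ℕ) : evenInd q * evenInd q = reps q * sqQuot q := by
  rw [sqQuot, evenInd]; ring

/-- The Euler factor of `oneModInv q` at `p` is `1 - oneMod q p · p^(-s)`, so only two terms of the
convolution survive. -/
theorem mul_oneModInv_prime_pow_succ (f : ArithmeticFunction ℝ) (q : ℕ) {p : ℕ} (hp : p.Prime)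
    (k : ℕ) : (f * oneModInv q) (p ^ (k + 1)) = f (p ^ (k + 1)) - oneMod q p * f (p ^ k) := by
  have h0 : oneModInv q (p ^ 0) = 1 := by simp [oneModInv, oneMod_one]
  have h1 : oneModInv q (p ^ 1) = - oneMod q p := by
    simp [oneModInv, moebius_apply_prime hp]
  rw [mul_comm f, mul_apply_prime_pow _ _ hp, sum_range_succ', sum_range_succ', sum_eq_zero]
  · rw [h0]
    simp only [zero_add, h1]
    simp
    ring
  · intro j _
    have : oneModInv q (p ^ (j + 1 + 1)) = 0 := by
      simp [oneModInv, moebius_apply_prime_pow hp]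
    rw [this, zero_mul]

theorem reps_prime_pow {q : ℕ} (hq : q = 3 ∨ q = 4) {p : ℕ} (hp : p.Prime) (k : ℕ) :
    reps q (p ^ k) = ∑ j ∈ range (k + 1), chi q p ^ j := by
  rw [reps, mul_comm, mul_apply_prime_pow _ _ hp]
  refine sum_congr rfl fun j _ => ?_
  rw [natCoe_apply, zeta_apply_ne (pow_ne_zero _ hp.ne_zero), chi_pow hq]
  simp

theorem evenInd_prime_pow {q : ℕ} (hq : q = 3 ∨ q = 4) {p : ℕ} (hp : p.Prime) (k : ℕ) :
    evenInd q (p ^ k) = if p % q = q - 1 ∧ Odd k then 0 else 1 := by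
  cases k with
  | zero => simp [(isMultiplicative_evenInd hq).map_one]
  | succ k =>
    rw [evenInd, mul_oneModInv_prime_pow_succ _ _ hp, reps_prime_pow hq hp, reps_prime_pow hq hp,
      oneMod_prime q hp, chi_apply hp.ne_zero]
    by_cases h1 : p % q = 1
    · have : ¬ (1 = q - 1) := by omega
      simp only [h1, if_true, one_pow, this, false_and, if_false]
      simp
    · by_cases h2 : p % q = q - 1
      · simp only [h2, show ¬ (q - 1 = 1) by omega, if_true, if_false, neg_one_geom_sum]
        by_cases h3 : Even (k + 1 + 1)
        · have : Odd (k + 1) := by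
            rw [Nat.even_add_one, Nat.not_even_iff_odd] at h3
            exact h3
          simp [h3, this]
        · have : ¬ Odd (k + 1) := by
            rw [Nat.even_add_one, Nat.not_even_iff_odd] at h3
            exact h3
          simp [h3, this]
      · simp [h1, h2, sum_range_succ']

theorem sqQuot_prime_pow_succ {q : ℕ} (hq : q = 3 ∨ q = 4) {p : ℕ} (hp : p.Prime) (k : ℕ) :
    sqQuot q (p ^ (k + 1)) =
      if p % q = 1 ∨ (p % q = q - 1 ∧ Odd (k + 1)) then 0 else 1 := by
  rw [sqQuot, mul_oneModInv_prime_pow_succ _ _ hp, evenInd_prime_pow hq hp,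
    evenInd_prime_pow hq hp, oneMod_prime q hp]
  by_cases h1 : p % q = 1
  · have : ¬ (1 = q - 1) := by omega
    simp [h1, this]
  · simp [h1]

theorem zeta_mul_oneModInv_mem (q n : ℕ) :
    0 ≤ ((ζ : ArithmeticFunction ℝ) * oneModInv q) n ∧
      ((ζ : ArithmeticFunction ℝ) * oneModInv q) n ≤ 1 := by
  refine map_mem_unitInterval (isMultiplicative_zeta.natCast.mul (isMultiplicative_oneModInv q))
    (fun p k hp => ?_) n
  cases k with
  | zero => simp [oneModInv, oneMod_one]
  | succ k =>
    have h (j : ℕ) : (ζ : ArithmeticFunction ℝ) (p ^ j) = 1 := by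
      rw [natCoe_apply, zeta_apply_ne (pow_ne_zero _ hp.ne_zero), Nat.cast_one]
    rw [mul_oneModInv_prime_pow_succ _ _ hp, h, h, oneMod_prime q hp]
    split_ifs <;> norm_num

theorem evenInd_eq {q : ℕ} (hq : q = 3 ∨ q = 4) {n : ℕ} (hn : n ≠ 0) :
    evenInd q n = if ∀ p ∈ n.primeFactors, p % q = q - 1 → Even (n.factorization p) then 1
      else 0 := by
  rw [(isMultiplicative_evenInd hq).multiplicative_factorization _ hn, Finsupp.prod,
    Nat.support_factorization]
  split_ifs with h
  · refine prod_eq_one fun p hp => ?_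
    rw [evenInd_prime_pow hq (Nat.prime_of_mem_primeFactors hp), if_neg]
    rintro ⟨h1, h2⟩
    exact Nat.not_even_iff_odd.2 h2 (h p hp h1)
  · push Not at h
    obtain ⟨p, hp, h1, h2⟩ := h
    refine prod_eq_zero hp ?_
    rw [evenInd_prime_pow hq (Nat.prime_of_mem_primeFactors hp), if_pos ⟨h1, by simpa using h2⟩]

theorem evenInd_mem {q : ℕ} (hq : q = 3 ∨ q = 4) (n : ℕ) : 0 ≤ evenInd q n ∧ evenInd q n ≤ 1 := by
  rcases eq_or_ne n 0 with rfl | hn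
  · simp
  · rw [evenInd_eq hq hn]
    split_ifs <;> norm_num

theorem reps_pmul_log {q : ℕ} (hq : q = 3 ∨ q = 4) :
    (reps q).pmul log = reps q * ((ζ : ArithmeticFunction ℝ) + chi q).pmul vonMangoldt := by
  have h1 : (chi q).pmul log = (chi q).pmul vonMangoldt * chi q := by
    rw [← vonMangoldt_mul_zeta, pmul_mul_distrib (chi_mul hq), pmul_zeta]
  have h2 : (ζ : ArithmeticFunction ℝ).pmul log = vonMangoldt * ζ := by
    rw [vonMangoldt_mul_zeta, zeta_pmul]
  have h3 : ((ζ : ArithmeticFunction ℝ) + chi q).pmul vonMangoldt = vonMangoldt + (chi q).pmul vonMangoldt := by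
    have : ((ζ : ArithmeticFunction ℝ) + chi q).pmul vonMangoldt
        = (ζ : ArithmeticFunction ℝ).pmul vonMangoldt + (chi q).pmul vonMangoldt := by
      ext n; simp only [pmul_apply, ArithmeticFunction.add_apply]; ring
    rw [this, zeta_pmul]
  rw [reps, log_pmul_mul, h1, h2, h3]
  ring

/-- Apply the derivation `log` to `oneMod q * oneModInv q = 1`; the logarithmic derivative of a
completely multiplicative function is its pointwise product with `Λ`. -/
theorem oneModInv_pmul_log (q : ℕ) :
    (oneModInv q).pmul log = - (oneModInv q * (oneMod q).pmul vonMangoldt) := by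
  have h1 : (oneMod q).pmul log = (oneMod q).pmul vonMangoldt * oneMod q := by
    rw [← vonMangoldt_mul_zeta, pmul_mul_distrib (oneMod_mul q), pmul_zeta]
  have h2 := log_pmul_mul (oneMod q) (oneModInv q)
  rw [oneMod_mul_oneModInv, h1] at h2
  have h3 : (1 : ArithmeticFunction ℝ).pmul log = 0 := by
    ext n
    rw [pmul_apply, one_apply, ArithmeticFunction.zero_apply]
    split_ifs with h <;> simp [h]
  rw [h3] at h2
  have h4 := oneMod_mul_oneModInv q
  linear_combination (-(oneModInv q)) * h2 - ((oneModInv q).pmul log +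
    oneModInv q * (oneMod q).pmul vonMangoldt) * h4

/-- This is `2 F'/F = (ζL)'/(ζL) + G'/G`, multiplied by `F`. Only the first summand produces a
logarithm in the summatory function. -/
theorem two_mul_evenInd_pmul_log {q : ℕ} (hq : q = 3 ∨ q = 4) :
    2 * (evenInd q).pmul log = oneModInv q * (reps q).pmul log + lam q * evenInd q := by
  have h : lam q = ((ζ : ArithmeticFunction ℝ) + chi q).pmul vonMangoldt - 2 * (oneMod q).pmul vonMangoldt := by
    rw [lam, two_mul, two_mul]
    ext n
    simp only [pmul_apply, sub_eq_add_neg, ArithmeticFunction.neg_apply, ArithmeticFunction.add_apply]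
    ring
  rw [h, evenInd, log_pmul_mul, oneModInv_pmul_log, reps_pmul_log hq]
  ring

/-! ### The bound for the sum of `lam q n / n` -/

/-- The prime dividing `q`, for `q = 3, 4`. -/
def ram (q : ℕ) : ℕ := if q = 3 then 3 else 2

theorem eq_ram {q : ℕ} (hq : q = 3 ∨ q = 4) {p : ℕ} (hp : p.Prime) (h1 : p % q ≠ 1)
    (h2 : p % q ≠ q - 1) : p = ram q := by
  rcases hq with rfl | rfl
  · have : 3 ∣ p := by omega
    exact ((Nat.prime_dvd_prime_iff_eq Nat.prime_three hp).1 this).symm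
  · have : 2 ∣ p := by omega
    exact ((Nat.prime_dvd_prime_iff_eq Nat.prime_two hp).1 this).symm

theorem lam_apply (q : ℕ) {n : ℕ} (hn : n ≠ 0) :
    lam q n = (1 + chi q n - 2 * oneMod q n) * vonMangoldt n := by
  rw [lam, two_mul, two_mul, pmul_apply, sub_eq_add_neg, sub_eq_add_neg,
    ArithmeticFunction.add_apply, ArithmeticFunction.add_apply, ArithmeticFunction.neg_apply,
    ArithmeticFunction.add_apply, natCoe_apply, zeta_apply_ne hn, Nat.cast_one]

theorem lam_prime_pow {q : ℕ} (hq : q = 3 ∨ q = 4) {p k : ℕ} (hp : p.Prime) (hk : k ≠ 0) :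
    lam q (p ^ k) = if p % q = 1 then 0 else if p % q = q - 1 then
      (if Even k then 2 * Real.log p else 0) else Real.log p := by
  rw [lam_apply q (pow_ne_zero _ hp.ne_zero), chi_pow hq, oneMod_pow, vonMangoldt_apply_pow hk,
    vonMangoldt_apply_prime hp, oneMod_prime q hp, chi_apply hp.ne_zero]
  by_cases h1 : p % q = 1
  · norm_num [h1]
  · by_cases h2 : p % q = q - 1
    · simp only [h2, show ¬ (q - 1 = 1) by omega, if_true, if_false]
      by_cases h3 : Even k
      · norm_num [h3, hk, h3.neg_one_pow]
      · norm_num [h3, hk, (Nat.not_even_iff_odd.1 h3).neg_one_pow]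
    · simp [h1, h2, hk]

theorem lam_nonneg {q : ℕ} (hq : q = 3 ∨ q = 4) (n : ℕ) : 0 ≤ lam q n := by
  rcases eq_or_ne n 0 with rfl | hn
  · simp
  by_cases h : IsPrimePow n
  · obtain ⟨p, k, hp, hk, rfl⟩ := h
    rw [lam_prime_pow hq hp.nat_prime hk.ne']
    have := Real.log_natCast_nonneg p
    split_ifs <;> positivity
  · rw [lam_apply q hn, vonMangoldt_eq_zero_iff.2 h, mul_zero]

/-- The function `lam q` lives on powers of the ramified prime and on even powers `(p^j)²` of inert
primes. The second family is relaxed to all squares `m²`, using `log p ≤ log (p^j)`, so that no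
information on primes is needed when summing. -/
theorem lam_div_le {q : ℕ} (hq : q = 3 ∨ q = 4) {n N : ℕ} (hn : n ∈ Ioc 0 N) :
    lam q n / n ≤ (∑ k ∈ Ioc 0 N, if ram q ^ k = n then Real.log (ram q) / (ram q : ℝ) ^ k else 0) +
      ∑ m ∈ Ioc 0 N, if m ^ 2 = n then 2 * Real.log m / (m : ℝ) ^ 2 else 0 := by
  rw [mem_Ioc] at hn
  have hA : ∀ k ∈ Ioc 0 N, (0 : ℝ) ≤
      if ram q ^ k = n then Real.log (ram q) / (ram q : ℝ) ^ k else 0 := by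
    intro k _
    have := Real.log_natCast_nonneg (ram q)
    split_ifs <;> positivity
  have hB : ∀ m ∈ Ioc 0 N, (0 : ℝ) ≤ if m ^ 2 = n then 2 * Real.log m / (m : ℝ) ^ 2 else 0 := by
    intro m _
    have := Real.log_natCast_nonneg m
    split_ifs <;> positivity
  by_cases h : IsPrimePow n
  · obtain ⟨p, k, hp, hk, rfl⟩ := h
    have hp := hp.nat_prime
    have hlog := Real.log_natCast_nonneg p
    rw [lam_prime_pow hq hp hk.ne']
    by_cases h1 : p % q = 1
    · rw [if_pos h1, zero_div]
      exact add_nonneg (sum_nonneg hA) (sum_nonneg hB)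
    rw [if_neg h1]
    by_cases h2 : p % q = q - 1
    · rw [if_pos h2]
      by_cases h3 : Even k
      · rw [if_pos h3]
        obtain ⟨j, rfl⟩ := h3
        have hj : j ≠ 0 := by omega
        have hpj : p ^ (j + j) = (p ^ j) ^ 2 := by ring
        have hmem : p ^ j ∈ Ioc 0 N := by
          rw [mem_Ioc]
          refine ⟨pow_pos hp.pos _, le_trans ?_ hn.2⟩
          exact Nat.pow_le_pow_right hp.pos (by omega)
        have h4 := single_le_sum hB hmem
        rw [if_pos hpj.symm] at h4
        refine le_trans ?_ (le_add_of_nonneg_left (sum_nonneg hA))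
        refine le_trans ?_ h4
        rw [hpj]
        push_cast
        gcongr
        · exact_mod_cast hp.pos
        · exact le_self_pow₀ (by exact_mod_cast hp.one_le) hj
      · rw [if_neg h3, zero_div]
        exact add_nonneg (sum_nonneg hA) (sum_nonneg hB)
    · rw [if_neg h2]
      have h5 := eq_ram hq hp h1 h2
      subst h5
      have hmem : k ∈ Ioc 0 N :=
        mem_Ioc.2 ⟨hk, (Nat.lt_pow_self hp.one_lt).le.trans hn.2⟩
      have h4 := single_le_sum hA hmem
      rw [if_pos rfl] at h4
      refine le_trans ?_ (le_add_of_nonneg_right (sum_nonneg hB))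
      refine le_trans ?_ h4
      push_cast
      exact le_rfl
  · rw [lam_apply q hn.1.ne', vonMangoldt_eq_zero_iff.2 h, mul_zero, zero_div]
    exact add_nonneg (sum_nonneg hA) (sum_nonneg hB)

theorem lt_log_four : 4 / 3 < Real.log 4 := by
  have := Real.log_two_gt_d9
  rw [show (4 : ℝ) = 2 ^ 2 by norm_num, Real.log_pow]
  push_cast
  linarith

/-- The extra term is the tail integral `∫_N^∞ log t / t² dt`. The left side is therefore
nonincreasing for `N ≥ 3`, and the constant bounds its value at `N = 3`. -/
theorem sum_log_div_sq_add_le {N : ℕ} (hN : 3 ≤ N) :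
    ∑ n ∈ Ioc 0 N, Real.log n / (n : ℝ) ^ 2 + (Real.log N + 1) / N ≤ 0.995 := by
  induction N, hN using Nat.le_induction with
  | base =>
    rw [show Ioc 0 3 = {1, 2, 3} by rfl]
    have h2 := Real.log_two_lt_d9
    have h3 := Real.log_three_lt_d9
    simp
    linarith
  | succ N hN ih =>
    rw [sum_Ioc_succ_top (by omega)]
    refine le_trans ?_ ih
    rw [add_assoc]
    gcongr
    push_cast
    have hN' : (3 : ℝ) ≤ N := by exact_mod_cast hN
    set x : ℝ := (N : ℝ)
    have h1 : Real.log (x + 1) - 1 / x ≤ Real.log x := by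
      have := Real.log_le_sub_one_of_pos (show 0 < (x + 1) / x by positivity)
      rw [Real.log_div (by positivity) (by positivity)] at this
      have h : (x + 1) / x - 1 = 1 / x := by field_simp; ring
      linarith
    have h2 : (x + 1) / x ≤ Real.log (x + 1) := by
      refine le_trans ?_ (lt_log_four.le.trans (Real.log_le_log (by norm_num) (by linarith)))
      rw [div_le_div_iff₀ (by positivity) (by norm_num)]
      linarith
    have h3 : (Real.log (x + 1) - 1 / x + 1) / x ≤ (Real.log x + 1) / x := by gcongr
    refine le_trans ?_ h3
    generalize Real.log (x + 1) = l at *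
    rw [div_add_div _ _ (by positivity) (by positivity), div_le_div_iff₀ (by positivity)
      (by positivity)]
    rw [div_le_iff₀ (by positivity)] at h2
    have h4 : (l - 1 / x + 1) * ((x + 1) ^ 2 * (x + 1)) - (l * (x + 1) + (x + 1) ^ 2 * (l + 1)) * x
       = (x + 1) * (l * x - (x + 1)) / x := by
      field_simp
      ring
    have h5 : 0 ≤ (x + 1) * (l * x - (x + 1)) / x :=
      div_nonneg (mul_nonneg (by positivity) (by linarith)) (by positivity)
    linarith

theorem sum_log_div_sq_le (N : ℕ) : ∑ n ∈ Ioc 0 N, Real.log n / (n : ℝ) ^ 2 ≤ 0.995 := by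
  have h := sum_log_div_sq_add_le (N := N + 3) (by omega)
  have h1 : 0 ≤ (Real.log (N + 3 : ℕ) + 1) / (N + 3 : ℕ) := by
    have := Real.log_natCast_nonneg (N + 3)
    positivity
  refine le_trans (sum_le_sum_of_subset_of_nonneg (Ioc_subset_Ioc_right (Nat.le_add_right N 3))
    fun i _ _ => ?_) (le_trans (le_add_of_nonneg_right h1) h)
  have := Real.log_natCast_nonneg i
  positivity

theorem sum_log_div_pow_le {q : ℕ} (hq : q = 3 ∨ q = 4) (N : ℕ) :
    ∑ k ∈ Ioc 0 N, Real.log (ram q) / (ram q : ℝ) ^ k ≤ 0.694 := by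
  have hl : Real.log (ram q) / (ram q - 1 : ℝ) ≤ 0.694 := by
    have h2 := Real.log_two_lt_d9
    have h3 := Real.log_three_lt_d9
    rcases hq with rfl | rfl <;> norm_num [ram] <;> linarith
  have hr : (2 : ℝ) ≤ ram q := by rcases hq with rfl | rfl <;> norm_num [ram]
  have hlog := Real.log_natCast_nonneg (ram q)
  have key : ∑ k ∈ Ioc 0 N, Real.log (ram q) / (ram q : ℝ) ^ k =
      Real.log (ram q) / (ram q - 1 : ℝ) * (1 - 1 / (ram q : ℝ) ^ N) := by
    generalize (ram q : ℝ) = l at *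
    have : l - 1 ≠ 0 := by linarith
    induction N with
    | zero => simp
    | succ N ih =>
      rw [sum_Ioc_succ_top (by omega), ih]
      field_simp
      ring
  rw [key]
  refine le_trans (mul_le_of_le_one_right (div_nonneg hlog (by linarith)) ?_) hl
  have : 0 ≤ 1 / (ram q : ℝ) ^ N := by positivity
  linarith

theorem sum_lam_div_le {q : ℕ} (hq : q = 3 ∨ q = 4) (N : ℕ) :
    ∑ n ∈ Ioc 0 N, lam q n / n ≤ 2.684 := by
  refine (sum_le_sum fun n hn => lam_div_le hq hn).trans ?_
  rw [sum_add_distrib, sum_comm, sum_comm (s := Ioc 0 N) (t := Ioc 0 N)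
    (f := fun n m => if m ^ 2 = n then 2 * Real.log m / (m : ℝ) ^ 2 else 0)]
  have h1 : ∑ k ∈ Ioc 0 N, ∑ n ∈ Ioc 0 N,
      (if ram q ^ k = n then Real.log (ram q) / (ram q : ℝ) ^ k else 0) ≤ 0.694 := by
    refine le_trans (sum_le_sum fun k _ => ?_) (sum_log_div_pow_le hq N)
    rw [sum_ite_eq]
    have := Real.log_natCast_nonneg (ram q)
    split_ifs
    · exact le_rfl
    · positivity
  have h2 : ∑ m ∈ Ioc 0 N, ∑ n ∈ Ioc 0 N,
      (if m ^ 2 = n then 2 * Real.log m / (m : ℝ) ^ 2 else 0) ≤ 2 * 0.995 := by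
    refine le_trans (sum_le_sum (g := fun m : ℕ => 2 * (Real.log m / (m : ℝ) ^ 2)) fun m _ => ?_) ?_
    · rw [sum_ite_eq, mul_div_assoc]
      have := Real.log_natCast_nonneg m
      split_ifs
      · exact le_rfl
      · positivity
    · rw [← mul_sum]
      have := sum_log_div_sq_le N
      gcongr
  linarith

/-! ### The summatory function of `reps q` and the values of `L(1, χ)` -/

theorem sum_chi_mul {q : ℕ} (hq : q = 3 ∨ q = 4) (f : ℕ → ℝ) (J : ℕ) :
    ∑ d ∈ Ioc 0 (q * J), chi q d * f d = ∑ j ∈ range J, (f (q * j + 1) - f (q * j + (q - 1))) := by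
  induction J with
  | zero => simp
  | succ J ih =>
    rw [sum_range_succ, ← ih]
    rcases hq with rfl | rfl
    · rw [show 3 * (J + 1) = 3 * J + 1 + 1 + 1 by ring, sum_Ioc_succ_top (by omega),
        sum_Ioc_succ_top (by omega), sum_Ioc_succ_top (by omega), chi_apply (by omega),
        chi_apply (by omega), chi_apply (by omega), show (3 * J + 1) % 3 = 1 by omega,
        show (3 * J + 1 + 1) % 3 = 2 by omega, show (3 * J + 1 + 1 + 1) % 3 = 0 by omega]
      norm_num
      ring
    · rw [show 4 * (J + 1) = 4 * J + 1 + 1 + 1 + 1 by ring, sum_Ioc_succ_top (by omega),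
        sum_Ioc_succ_top (by omega), sum_Ioc_succ_top (by omega), sum_Ioc_succ_top (by omega),
        chi_apply (by omega), chi_apply (by omega), chi_apply (by omega), chi_apply (by omega),
        show (4 * J + 1) % 4 = 1 by omega, show (4 * J + 1 + 1) % 4 = 2 by omega,
        show (4 * J + 1 + 1 + 1) % 4 = 3 by omega, show (4 * J + 1 + 1 + 1 + 1) % 4 = 0 by omega]
      norm_num
      ring

/-- The Leibniz estimate for alternating sums, one period of the character at a time: each block is
nonnegative, and the blocks are dominated by a telescoping sum. -/
theorem sum_block_mem {q : ℕ} (hq : 2 ≤ q) {f : ℕ → ℝ} (h0 : ∀ n, 0 ≤ f n)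
    (hf : ∀ m n, 0 < m → m ≤ n → f n ≤ f m) {k J : ℕ} (hk : k ≤ J) :
    0 ≤ ∑ j ∈ Ico k J, (f (q * j + 1) - f (q * j + (q - 1))) ∧
      ∑ j ∈ Ico k J, (f (q * j + 1) - f (q * j + (q - 1))) ≤ f (q * k + 1) := by
  refine ⟨sum_nonneg fun j _ => sub_nonneg.2 (hf _ _ (by omega) (by omega)), ?_⟩
  suffices h : ∑ j ∈ Ico k J, (f (q * j + 1) - f (q * j + (q - 1))) ≤
      f (q * k + 1) - f (q * J + 1) from h.trans (sub_le_self _ (h0 _))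
  induction J, hk using Nat.le_induction with
  | base => simp
  | succ J hkJ ih =>
    rw [sum_Ico_succ_top hkJ]
    have : f (q * (J + 1) + 1) ≤ f (q * J + (q - 1)) :=
      hf _ _ (by omega) (by rw [mul_add]; omega)
    linarith

/-- The value at `1` of the `L`-function of `chi q`. -/
noncomputable def rho (q : ℕ) : ℝ :=
  ∑' j : ℕ, (1 / ((q * j + 1 : ℕ) : ℝ) - 1 / ((q * j + (q - 1) : ℕ) : ℝ))

theorem one_div_natCast_le (m n : ℕ) (hm : 0 < m) (h : m ≤ n) : 1 / (n : ℝ) ≤ 1 / (m : ℝ) :=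
  one_div_le_one_div_of_le (by exact_mod_cast hm) (by exact_mod_cast h)

theorem tendsto_rho {q : ℕ} (hq : 2 ≤ q) :
    Tendsto (fun J => ∑ j ∈ range J,
      (1 / ((q * j + 1 : ℕ) : ℝ) - 1 / ((q * j + (q - 1) : ℕ) : ℝ))) atTop (𝓝 (rho q)) := by
  suffices h : Summable fun j : ℕ =>
      1 / ((q * j + 1 : ℕ) : ℝ) - 1 / ((q * j + (q - 1) : ℕ) : ℝ) from h.hasSum.tendsto_sum_nat
  apply summable_of_sum_range_le (c := 1)
  · intro j
    exact sub_nonneg.2 (one_div_natCast_le _ _ (by omega) (by omega))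
  · intro J
    have := (sum_block_mem hq (f := fun n : ℕ => 1 / (n : ℝ)) (fun n => by positivity)
      one_div_natCast_le (Nat.zero_le J)).2
    rw [range_eq_Ico]
    exact this.trans (by simp)

/-- The sum is `∑ χ(d) ⌊t/d⌋`. In each of the first `k` blocks, replacing the floors by `t/d` costs
at most `1`; the remaining blocks, with or without floors, lie between `0` and their leading term,
which is at most `t/(qk+1)`. -/
theorem abs_sum_reps_sub_le {q : ℕ} (hq : q = 3 ∨ q = 4) {t : ℝ} (ht : 0 ≤ t) (k : ℕ) :
    |∑ n ∈ Ioc 0 ⌊t⌋₊, reps q n - rho q * t| ≤ k + t / (q * k + 1) := by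
  have hq2 : 2 ≤ q := by omega
  have hR (J : ℕ) (hJ : ⌊t⌋₊ ≤ J) : ∑ n ∈ Ioc 0 ⌊t⌋₊, reps q n =
      ∑ j ∈ range J, (((⌊t⌋₊ / (q * j + 1) : ℕ) : ℝ) - ((⌊t⌋₊ / (q * j + (q - 1)) : ℕ) : ℝ)) := by
    rw [reps, mul_comm, sum_Ioc_mul_zeta_eq_sum,
      ← sum_chi_mul hq (fun d => ((⌊t⌋₊ / d : ℕ) : ℝ))]
    refine sum_subset (Ioc_subset_Ioc_right (by nlinarith)) fun d hd hd' => ?_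
    rw [mem_Ioc] at hd hd'
    rw [Nat.div_eq_of_lt (by omega), Nat.cast_zero, mul_zero]
  have hfl (d : ℕ) : ((⌊t⌋₊ / d : ℕ) : ℝ) ≤ t * (1 / d) ∧
      t * (1 / d) - 1 ≤ ((⌊t⌋₊ / d : ℕ) : ℝ) := by
    rw [← Nat.floor_div_natCast, mul_one_div]
    exact ⟨Nat.floor_le (by positivity), (Nat.sub_one_lt_floor _).le⟩
  have hJ (J : ℕ) (h1 : ⌊t⌋₊ ≤ J) (h2 : k ≤ J) :
      |∑ n ∈ Ioc 0 ⌊t⌋₊, reps q n - (∑ j ∈ range J,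
        (1 / ((q * j + 1 : ℕ) : ℝ) - 1 / ((q * j + (q - 1) : ℕ) : ℝ))) * t| ≤
      k + t / (q * k + 1) := by
    rw [hR J h1, ← sum_range_add_sum_Ico _ h2, ← sum_range_add_sum_Ico _ h2]
    have hA := sum_block_mem hq2 (f := fun d => ((⌊t⌋₊ / d : ℕ) : ℝ)) (fun n => by positivity)
      (fun m n hm hmn => by exact_mod_cast Nat.div_le_div_left hmn hm) h2
    have hB := sum_block_mem hq2 (f := fun n : ℕ => 1 / (n : ℝ)) (fun n => by positivity)
      one_div_natCast_le h2
    have hC := (hfl (q * k + 1)).1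
    have hD : |∑ j ∈ range k, (((⌊t⌋₊ / (q * j + 1) : ℕ) : ℝ) -
        ((⌊t⌋₊ / (q * j + (q - 1)) : ℕ) : ℝ)) - (∑ j ∈ range k,
        (1 / ((q * j + 1 : ℕ) : ℝ) - 1 / ((q * j + (q - 1) : ℕ) : ℝ))) * t| ≤ k := by
      rw [sum_mul, ← sum_sub_distrib]
      refine (abs_sum_le_sum_abs _ _).trans ?_
      refine (sum_le_card_nsmul _ _ 1 fun j _ => ?_).trans (by simp)
      have a1 := hfl (q * j + 1)
      have a2 := hfl (q * j + (q - 1))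
      rw [abs_le, sub_mul, mul_comm _ t, mul_comm _ t]
      constructor <;> linarith [a1.1, a1.2, a2.1, a2.2]
    have hE : t / (q * k + 1) = t * (1 / ((q * k + 1 : ℕ) : ℝ)) := by push_cast; ring
    rw [hE]
    have hB1 := mul_nonneg hB.1 ht
    have hB2 := mul_le_mul_of_nonneg_right hB.2 ht
    rw [add_mul]
    rw [abs_le] at hD ⊢
    constructor <;> linarith [hA.1, hA.2, hD.1, hD.2]
  refine le_of_tendsto ((tendsto_const_nhds.sub ((tendsto_rho hq2).mul_const t)).abs) ?_
  filter_upwards [eventually_ge_atTop (max ⌊t⌋₊ k)] with J h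
  exact hJ J (le_trans (le_max_left _ _) h) (le_trans (le_max_right _ _) h)

theorem abs_sum_reps_sub_le_sqrt {q : ℕ} (hq : q = 3 ∨ q = 4) {t : ℝ} (ht : 1 ≤ t) :
    |∑ n ∈ Ioc 0 ⌊t⌋₊, reps q n - rho q * t| ≤ 2 * √(t / q) + (1 - 1 / q) := by
  have hq0 : (3 : ℝ) ≤ q := by rcases hq with rfl | rfl <;> norm_num
  have hs : 1 / (q : ℝ) ≤ √(t / q) := by
    refine Real.le_sqrt_of_sq_le ?_
    rw [div_pow, one_pow, div_le_div_iff₀ (by positivity) (by positivity)]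
    nlinarith
  have hs0 : 0 < √(t / q) := lt_of_lt_of_le (by positivity) hs
  -- The real minimiser of `k + t/(qk+1)` is `√(t/q) - 1/q`; rounding it up costs less than `1`.
  set k := ⌈√(t / q) - 1 / q⌉₊ with hk
  refine (abs_sum_reps_sub_le hq (by linarith) k).trans ?_
  have h1 : (k : ℝ) < √(t / q) - 1 / q + 1 := Nat.ceil_lt_add_one (by linarith)
  have h2 : √(t / q) - 1 / q ≤ k := Nat.le_ceil _
  have h3 : t / (q * k + 1) ≤ √(t / q) := by
    rw [div_le_iff₀ (by positivity)]
    have h4 : √(t / q) * √(t / q) = t / q := Real.mul_self_sqrt (by positivity)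
    have h5 : q * √(t / q) ≤ q * k + 1 := by
      have := mul_le_mul_of_nonneg_left h2 (by linarith : (0 : ℝ) ≤ q)
      rw [mul_sub, mul_one_div_cancel (by linarith)] at this
      linarith
    calc t = √(t / q) * (q * √(t / q)) := by
          rw [mul_left_comm, h4, mul_div_cancel₀ _ (by linarith)]
      _ ≤ _ := by gcongr
  linarith

theorem rho_four : rho 4 = Real.pi / 4 := by
  refine tendsto_nhds_unique (tendsto_rho (by norm_num)) ?_
  have h := Real.tendsto_sum_pi_div_four.comp (tendsto_id.const_mul_atTop' (r := 2) (by norm_num))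
  refine h.congr fun J => ?_
  simp only [Function.comp, id]
  induction J with
  | zero => simp
  | succ J ih =>
    rw [mul_add, mul_one, sum_range_succ, sum_range_succ, ih, sum_range_succ, pow_succ,
      pow_mul]
    push_cast
    norm_num
    ring

theorem integral_one_div_quadratic :
    ∫ t in (0 : ℝ)..1, 1 / (1 + t + t ^ 2) = Real.pi / (3 * √3) := by
  have h3 : √3 * √3 = (3 : ℝ) := Real.mul_self_sqrt (by norm_num)
  have h3' : (0 : ℝ) < √3 := by positivity
  have hpos (t : ℝ) : 0 < 1 + t + t ^ 2 := by nlinarith [sq_nonneg (t + 1 / 2)]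
  have hd (t : ℝ) : HasDerivAt (fun t => 2 / √3 * Real.arctan ((2 * t + 1) / √3))
      (1 / (1 + t + t ^ 2)) t := by
    have h1 : HasDerivAt (fun t : ℝ => (2 * t + 1) / √3) (2 / √3) t := by
      simpa using (((hasDerivAt_id t).const_mul 2).add_const 1).div_const (√3)
    refine (h1.arctan.const_mul (2 / √3)).congr_deriv ?_
    have := hpos t
    have h4 : 1 + ((2 * t + 1) / √3) ^ 2 = 4 / 3 * (1 + t + t ^ 2) := by
      rw [div_pow, sq (√3), h3]; ring
    rw [h4]
    field_simp
    nlinarith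
  rw [intervalIntegral.integral_eq_sub_of_hasDerivAt (fun t _ => hd t)]
  · have e1 : (2 * (1 : ℝ) + 1) / √3 = Real.tan (Real.pi / 3) := by
      rw [Real.tan_pi_div_three, div_eq_iff h3'.ne', h3]; norm_num
    have e2 : (2 * (0 : ℝ) + 1) / √3 = Real.tan (Real.pi / 6) := by
      rw [Real.tan_pi_div_six]; norm_num
    have := Real.pi_pos
    rw [e1, e2, Real.arctan_tan (by linarith) (by linarith),
      Real.arctan_tan (by linarith) (by linarith)]
    field_simp
    ring
  · refine Continuous.intervalIntegrable ?_ _ _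
    exact continuous_const.div (by fun_prop) fun t => (hpos t).ne'

/-- Each block is `∫₀¹ t^(3j) (1 - t) dt`, and `(1 - t)/(1 - t³) = 1/(1 + t + t²)`. The remainder
after `J` blocks carries a factor `t^(3J)` and tends to `0`. -/
theorem rho_three : rho 3 = Real.pi / (3 * √3) := by
  rw [← integral_one_div_quadratic]
  refine tendsto_nhds_unique (tendsto_rho (by norm_num)) ?_
  have hpos (t : ℝ) : 0 < 1 + t + t ^ 2 := by nlinarith [sq_nonneg (t + 1 / 2)]
  have hint (J : ℕ) : IntervalIntegrable (fun t : ℝ => t ^ (3 * J) / (1 + t + t ^ 2))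
      MeasureTheory.volume 0 1 :=
    ((continuous_pow _).div (by fun_prop) fun t => (hpos t).ne').intervalIntegrable _ _
  have hint' : IntervalIntegrable (fun t : ℝ => 1 / (1 + t + t ^ 2))
      MeasureTheory.volume 0 1 :=
    (continuous_const.div (by fun_prop) fun t => (hpos t).ne').intervalIntegrable _ _
  have key (J : ℕ) : ∑ j ∈ range J, (1 / ((3 * j + 1 : ℕ) : ℝ) - 1 / ((3 * j + (3 - 1) : ℕ) : ℝ)) =
      (∫ t in (0 : ℝ)..1, 1 / (1 + t + t ^ 2)) -
        ∫ t in (0 : ℝ)..1, t ^ (3 * J) / (1 + t + t ^ 2) := by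
    induction J with
    | zero => simp
    | succ J ih =>
      rw [sum_range_succ, ih]
      have h1 : (∫ t in (0 : ℝ)..1, t ^ (3 * J) / (1 + t + t ^ 2)) -
          (∫ t in (0 : ℝ)..1, t ^ (3 * (J + 1)) / (1 + t + t ^ 2)) =
          ∫ t in (0 : ℝ)..1, (t ^ (3 * J) - t ^ (3 * J + 1)) := by
        rw [← intervalIntegral.integral_sub (hint J) (hint (J + 1))]
        refine intervalIntegral.integral_congr fun t _ => ?_
        have := (hpos t).ne'
        rw [← sub_div, div_eq_iff this]
        ring
      rw [intervalIntegral.integral_sub (by simp) (by simp), integral_pow, integral_pow] at h1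
      push_cast at h1 ⊢
      simp only [one_pow, zero_pow (Nat.succ_ne_zero _), sub_zero] at h1
      norm_num at h1 ⊢
      rw [add_assoc, show (1 : ℝ) + 1 = 2 by norm_num] at h1
      linarith
  simp_rw [key]
  conv => rhs; rw [← sub_zero (∫ t in (0 : ℝ)..1, 1 / (1 + t + t ^ 2))]
  refine tendsto_const_nhds.sub ?_
  refine squeeze_zero (g := fun J : ℕ => 1 / ((J : ℝ) + 1)) (fun J => ?_) (fun J => ?_)
    tendsto_one_div_add_atTop_nhds_zero_nat
  · refine intervalIntegral.integral_nonneg zero_le_one fun t ht => ?_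
    have := hpos t
    have := ht.1
    positivity
  · calc ∫ t in (0 : ℝ)..1, t ^ (3 * J) / (1 + t + t ^ 2) ≤ ∫ t in (0 : ℝ)..1, t ^ (3 * J) := by
          refine intervalIntegral.integral_mono_on zero_le_one (hint J) (by simp) fun t ht => ?_
          have h0 := ht.1
          exact div_le_self (by positivity) (by nlinarith)
      _ ≤ 1 / ((J : ℝ) + 1) := by
          rw [integral_pow]
          simp only [one_pow, zero_pow (Nat.succ_ne_zero _), sub_zero]
          refine one_div_le_one_div_of_le (by positivity) ?_
          push_cast
          nlinarith [(Nat.cast_nonneg J : (0 : ℝ) ≤ J)]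

/-! ### Abel summation against the kernel `log n - y / n` -/

theorem measurable_sum_floor (f : ℕ → ℝ) : Measurable fun t : ℝ => ∑ n ∈ Ioc 0 ⌊t⌋₊, f n :=
  (measurable_from_nat (f := fun N => ∑ n ∈ Ioc 0 N, f n)).comp Nat.measurable_floor

theorem sum_Icc_zero_eq {f : ℕ → ℝ} (hf : f 0 = 0) (N : ℕ) :
    ∑ n ∈ Icc 0 N, f n = ∑ n ∈ Ioc 0 N, f n := by
  rw [← sum_Ioc_add_eq_sum_Icc (Nat.zero_le N), hf, add_zero]

section ErrorTerm

variable {E : ℝ → ℝ} {c₀ c₁ : ℝ}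

theorem norm_div_sq_le (hE : ∀ t, 1 ≤ t → |E t| ≤ c₀ * √t + c₁) {t : ℝ} (ht : 1 ≤ t) :
    ‖E t / t ^ 2‖ ≤ c₀ * t ^ (-(3 / 2) : ℝ) + c₁ * t ^ (-2 : ℝ) := by
  have ht0 : 0 < t := by linarith
  rw [norm_div, Real.norm_eq_abs, Real.norm_eq_abs, abs_of_pos (by positivity : 0 < t ^ 2),
    div_le_iff₀ (by positivity)]
  refine (hE t ht).trans_eq ?_
  rw [add_mul, mul_assoc, mul_assoc, ← Real.rpow_natCast t 2, ← Real.rpow_add ht0,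
    ← Real.rpow_add ht0, Real.sqrt_eq_rpow]
  norm_num

theorem norm_div_le (hE : ∀ t, 1 ≤ t → |E t| ≤ c₀ * √t + c₁) {t : ℝ} (ht : 1 ≤ t) :
    ‖E t / t‖ ≤ c₀ * t ^ (-(1 / 2) : ℝ) + c₁ * t⁻¹ := by
  have ht0 : 0 < t := by linarith
  rw [norm_div, Real.norm_eq_abs, Real.norm_eq_abs, abs_of_pos ht0, div_le_iff₀ ht0]
  refine (hE t ht).trans_eq ?_
  have h1 : t ^ (-(1 / 2) : ℝ) * t = √t := by
    rw [Real.sqrt_eq_rpow]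
    nth_rw 2 [← Real.rpow_one t]
    rw [← Real.rpow_add ht0]
    norm_num
  rw [add_mul, mul_assoc, mul_assoc, h1, inv_mul_cancel₀ ht0.ne', mul_one]

theorem integrableOn_bound (c₀ c₁ : ℝ) {y : ℝ} (hy : 1 ≤ y) :
    IntegrableOn (fun t : ℝ => c₀ * t ^ (-(3 / 2) : ℝ) + c₁ * t ^ (-2 : ℝ)) (Set.Ioi y) :=
  ((integrableOn_Ioi_rpow_of_lt (by norm_num) (by linarith)).const_mul _).add
    ((integrableOn_Ioi_rpow_of_lt (by norm_num) (by linarith)).const_mul _)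

theorem integrableOn_div_sq (hm : Measurable E) (hE : ∀ t, 1 ≤ t → |E t| ≤ c₀ * √t + c₁) {y : ℝ}
    (hy : 1 ≤ y) : IntegrableOn (fun t => E t / t ^ 2) (Set.Ioi y) := by
  refine (integrableOn_bound c₀ c₁ hy).mono' (hm.div (by fun_prop)).aestronglyMeasurable ?_
  refine (ae_restrict_iff' measurableSet_Ioi).2 (Eventually.of_forall fun t ht => ?_)
  exact norm_div_sq_le hE (hy.trans (le_of_lt ht))

theorem abs_mul_integral_Ioi_le (hE : ∀ t, 1 ≤ t → |E t| ≤ c₀ * √t + c₁) {y : ℝ} (hy : 1 ≤ y) :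
    |y * ∫ t in Set.Ioi y, E t / t ^ 2| ≤ 2 * c₀ * √y + c₁ := by
  have hy0 : 0 < y := by linarith
  have h : ‖∫ t in Set.Ioi y, E t / t ^ 2‖ ≤
      ∫ t in Set.Ioi y, (c₀ * t ^ (-(3 / 2) : ℝ) + c₁ * t ^ (-2 : ℝ)) := by
    refine norm_integral_le_of_norm_le (integrableOn_bound c₀ c₁ hy) ?_
    refine (ae_restrict_iff' measurableSet_Ioi).2 (Eventually.of_forall fun t ht => ?_)
    exact norm_div_sq_le hE (hy.trans (le_of_lt ht))
  rw [integral_add ((integrableOn_Ioi_rpow_of_lt (by norm_num) hy0).const_mul _)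
    ((integrableOn_Ioi_rpow_of_lt (by norm_num) hy0).const_mul _), integral_const_mul,
    integral_const_mul, integral_Ioi_rpow_of_lt (by norm_num) hy0,
    integral_Ioi_rpow_of_lt (by norm_num) hy0] at h
  rw [abs_mul, abs_of_pos hy0, ← Real.norm_eq_abs]
  refine (mul_le_mul_of_nonneg_left h hy0.le).trans_eq ?_
  have h1 : y * y ^ (-(3 / 2) + 1 : ℝ) = √y := by
    rw [Real.sqrt_eq_rpow]
    nth_rw 1 [← Real.rpow_one y]
    rw [← Real.rpow_add hy0]
    norm_num
  have h2 : y * y ^ (-2 + 1 : ℝ) = 1 := by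
    nth_rw 1 [← Real.rpow_one y]
    rw [← Real.rpow_add hy0]
    norm_num
  linear_combination (2 * c₀) * h1 + c₁ * h2

theorem integrableOn_div (hm : Measurable E) (hE : ∀ t, 1 ≤ t → |E t| ≤ c₀ * √t + c₁) (y : ℝ) :
    IntegrableOn (fun t => E t / t) (Set.Ioc 1 y) := by
  have hc : 0 ≤ c₀ * √1 + c₁ := (abs_nonneg _).trans (hE 1 le_rfl)
  refine Measure.integrableOn_of_bounded (M := |c₀| + |c₁|) (by simp)
    (hm.div (by fun_prop)).aestronglyMeasurable ?_
  refine (ae_restrict_iff' measurableSet_Ioc).2 (Eventually.of_forall fun t ht => ?_)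
  have h1 : (1 : ℝ) ≤ t := ht.1.le
  refine (norm_div_le hE h1).trans ?_
  have h2 : t ^ (-(1 / 2) : ℝ) ≤ 1 := Real.rpow_le_one_of_one_le_of_nonpos h1 (by norm_num)
  have h3 : 0 ≤ t ^ (-(1 / 2) : ℝ) := Real.rpow_nonneg (by linarith) _
  have h4 : t⁻¹ ≤ 1 := inv_le_one_of_one_le₀ h1
  have h5 : 0 ≤ t⁻¹ := by positivity
  gcongr
  · calc c₀ * t ^ (-(1 / 2) : ℝ) ≤ |c₀| * t ^ (-(1 / 2) : ℝ) := by gcongr; exact le_abs_self _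
      _ ≤ _ := mul_le_of_le_one_right (abs_nonneg _) h2
  · calc c₁ * t⁻¹ ≤ |c₁| * t⁻¹ := by gcongr; exact le_abs_self _
      _ ≤ _ := mul_le_of_le_one_right (abs_nonneg _) h4

theorem abs_integral_Ioc_le (hE : ∀ t, 1 ≤ t → |E t| ≤ c₀ * √t + c₁) {y : ℝ} (hy : 1 ≤ y) :
    |∫ t in Set.Ioc 1 y, E t / t| ≤ 2 * c₀ * (√y - 1) + c₁ * Real.log y := by
  have hy0 : 0 < y := by linarith
  have hi1 : IntervalIntegrable (fun t : ℝ => c₀ * t ^ (-(1 / 2) : ℝ)) volume 1 y :=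
    (intervalIntegral.intervalIntegrable_rpow' (by norm_num)).const_mul _
  have hi2 : IntervalIntegrable (fun t : ℝ => c₁ * t⁻¹) volume 1 y := by
    refine IntervalIntegrable.const_mul ?_ _
    refine intervalIntegral.intervalIntegrable_inv (fun t ht => ?_) continuousOn_id
    rw [Set.uIcc_of_le hy] at ht
    linarith [ht.1]
  have h : ‖∫ t in Set.Ioc 1 y, E t / t‖ ≤
      ∫ t in Set.Ioc 1 y, (c₀ * t ^ (-(1 / 2) : ℝ) + c₁ * t⁻¹) := by
    refine norm_integral_le_of_norm_le
      ((intervalIntegrable_iff_integrableOn_Ioc_of_le hy).1 (hi1.add hi2)) ?_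
    refine (ae_restrict_iff' measurableSet_Ioc).2 (Eventually.of_forall fun t ht => ?_)
    exact norm_div_le hE ht.1.le
  rw [← intervalIntegral.integral_of_le hy, ← intervalIntegral.integral_of_le hy,
    intervalIntegral.integral_add hi1 hi2, intervalIntegral.integral_const_mul,
    intervalIntegral.integral_const_mul, integral_rpow (Or.inl (by norm_num)),
    integral_inv_of_pos one_pos hy0, div_one] at h
  rw [← Real.norm_eq_abs, ← intervalIntegral.integral_of_le hy]
  refine h.trans_eq ?_
  have h1 : y ^ (-(1 / 2) + 1 : ℝ) = √y := by rw [Real.sqrt_eq_rpow]; norm_num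
  rw [h1, Real.one_rpow]
  ring

end ErrorTerm

/-- Abel summation with weight `log t - y/t`, whose value at `t = y` is `log y - 1`. -/
theorem sum_mul_log_sub_div_eq {f : ℕ → ℝ} (hf : f 0 = 0) {y : ℝ} (hy : 1 ≤ y) :
    ∑ n ∈ Ioc 0 ⌊y⌋₊, f n * (Real.log n - y / n) =
      (Real.log y - 1) * ∑ n ∈ Ioc 0 ⌊y⌋₊, f n -
        ∫ t in Set.Ioc 1 y, (1 / t + y / t ^ 2) * ∑ n ∈ Ioc 0 ⌊t⌋₊, f n := by
  have hd {t : ℝ} (ht : t ≠ 0) :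
      HasDerivAt (fun t => Real.log t - y / t) (1 / t + y / t ^ 2) t := by
    refine ((Real.hasDerivAt_log ht).sub ((hasDerivAt_inv ht).const_mul y)).congr_deriv ?_
    rw [one_div, mul_neg, sub_neg_eq_add, div_eq_mul_inv]
  have hc : ContinuousOn (fun t : ℝ => 1 / t + y / t ^ 2) (Set.Icc 1 y) := by
    have h0 : ∀ t ∈ Set.Icc 1 y, t ≠ 0 := fun t ht => by linarith [ht.1]
    exact (continuousOn_const.div continuousOn_id h0).add
      (continuousOn_const.div (continuousOn_pow 2) fun t ht => pow_ne_zero _ (h0 t ht))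
  have h := sum_mul_eq_sub_integral_mul₀ (f := fun t => Real.log t - y / t) f hf y
    (fun t ht => (hd (by linarith [ht.1])).differentiableAt) ?_
  · rw [sum_Icc_zero_eq (f := fun k : ℕ => (Real.log k - y / k) * f k) (by simp [hf]),
      sum_Icc_zero_eq hf, div_self (by linarith)] at h
    simp_rw [mul_comm (f _)]
    rw [h]
    congr 1
    refine setIntegral_congr_fun measurableSet_Ioc fun t ht => ?_
    rw [sum_Icc_zero_eq hf, (hd (by linarith [ht.1])).deriv]
  · refine (hc.integrableOn_Icc).congr_fun (fun t ht => ?_) measurableSet_Icc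
    rw [(hd (by linarith [ht.1])).deriv]

/-- If the summatory function of `f` is `ρ t` up to an error `c₀ √t + c₁`, then so is, up to a
linear term, the sum of `f n (log n - y / n)`. -/
theorem exists_sum_mul_log_sub_div {f : ℕ → ℝ} (hf : f 0 = 0) {ρ c₀ c₁ : ℝ} (hρ : 0 ≤ ρ)
    (hR : ∀ t, 1 ≤ t → |∑ n ∈ Ioc 0 ⌊t⌋₊, f n - ρ * t| ≤ c₀ * √t + c₁) :
    ∃ c : ℝ, |c| ≤ 2 * ρ + 2 * c₀ + c₁ ∧ ∀ y, 1 ≤ y →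
      |∑ n ∈ Ioc 0 ⌊y⌋₊, f n * (Real.log n - y / n) + c * y| ≤
        ρ + (c₀ * √y + c₁) * |Real.log y - 1| + (4 * c₀ * √y - 2 * c₀ + c₁ * Real.log y + c₁) := by
  set E : ℝ → ℝ := fun t => ∑ n ∈ Ioc 0 ⌊t⌋₊, f n - ρ * t with hEdef
  have hm : Measurable E := (measurable_sum_floor f).sub (by fun_prop)
  -- The main term `ρ t` contributes exactly `-2ρy + ρ`, its `y log y` parts cancelling. Extending
  -- `∫₁^y E/t²` to infinity makes the coefficient of `y` constant, at the price of the tail `y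
  -- ∫_y^∞ E/t²`.
  refine ⟨2 * ρ + ∫ t in Set.Ioi 1, E t / t ^ 2, ?_, fun y hy => ?_⟩
  · have h1 := abs_mul_integral_Ioi_le hR le_rfl
    rw [one_mul, Real.sqrt_one, mul_one] at h1
    refine (abs_add_le _ _).trans ?_
    rw [abs_of_nonneg (by positivity : 0 ≤ 2 * ρ)]
    linarith
  · have hy0 : 0 < y := by linarith
    have hsplit : ∫ t in Set.Ioi 1, E t / t ^ 2 =
        (∫ t in Set.Ioc 1 y, E t / t ^ 2) + ∫ t in Set.Ioi y, E t / t ^ 2 := by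
      have h1 : IntegrableOn (fun t => E t / t ^ 2) (Set.Ioc 1 y) :=
        (integrableOn_div_sq hm hR le_rfl).mono_set Set.Ioc_subset_Ioi_self
      rw [← setIntegral_union (Set.Ioc_disjoint_Ioi le_rfl) measurableSet_Ioi h1
        (integrableOn_div_sq hm hR hy), Set.Ioc_union_Ioi_eq_Ioi hy]
    have hi1 : IntervalIntegrable (fun t : ℝ => ρ) volume 1 y := by simp
    have hi2 : IntervalIntegrable (fun t : ℝ => ρ * y * t⁻¹) volume 1 y := by
      refine IntervalIntegrable.const_mul ?_ _
      refine intervalIntegral.intervalIntegrable_inv (fun t ht => ?_) continuousOn_id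
      rw [Set.uIcc_of_le hy] at ht
      linarith [ht.1]
    have hint : ∫ t in Set.Ioc 1 y, (1 / t + y / t ^ 2) * ∑ n ∈ Ioc 0 ⌊t⌋₊, f n =
        ρ * (y - 1) + ρ * y * Real.log y + (∫ t in Set.Ioc 1 y, E t / t) +
          y * ∫ t in Set.Ioc 1 y, E t / t ^ 2 := by
      have e1 : ρ * (y - 1) + ρ * y * Real.log y = ∫ t in Set.Ioc 1 y, (ρ + ρ * y * t⁻¹) := by
        rw [← intervalIntegral.integral_of_le hy, intervalIntegral.integral_add hi1 hi2,
          intervalIntegral.integral_const_mul, integral_inv_of_pos one_pos hy0,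
          intervalIntegral.integral_const, div_one, smul_eq_mul]
        ring
      have i1 := (intervalIntegrable_iff_integrableOn_Ioc_of_le hy).1 (hi1.add hi2)
      have i2 := integrableOn_div hm hR y
      have i3 : IntegrableOn (fun t => y * (E t / t ^ 2)) (Set.Ioc 1 y) :=
        ((integrableOn_div_sq hm hR le_rfl).mono_set Set.Ioc_subset_Ioi_self).const_mul y
      have i4 : IntegrableOn (fun t => ρ + ρ * y * t⁻¹ + E t / t) (Set.Ioc 1 y) := i1.add i2
      rw [e1, ← integral_const_mul, ← integral_add i1 i2, ← integral_add i4 i3]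
      refine setIntegral_congr_fun measurableSet_Ioc fun t ht => ?_
      have ht0 : t ≠ 0 := by linarith [ht.1]
      simp only [hEdef]
      generalize ∑ n ∈ Ioc 0 ⌊t⌋₊, f n = R
      field_simp
      ring
    have hsum : ∑ n ∈ Ioc 0 ⌊y⌋₊, f n = ρ * y + E y := by simp [hEdef]
    rw [sum_mul_log_sub_div_eq hf hy, hint, hsplit, hsum]
    have b1 := abs_mul_integral_Ioi_le hR hy
    have b2 := abs_integral_Ioc_le hR hy
    have b3 : |(Real.log y - 1) * E y| ≤ (c₀ * √y + c₁) * |Real.log y - 1| := by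
      rw [abs_mul, mul_comm]
      exact mul_le_mul_of_nonneg_right (hR y hy) (abs_nonneg _)
    change |∫ t in Set.Ioc 1 y, E t / t| ≤ _ at b2
    change |y * ∫ t in Set.Ioi y, E t / t ^ 2| ≤ _ at b1
    generalize (∫ t in Set.Ioi y, E t / t ^ 2) = I1 at *
    generalize (∫ t in Set.Ioc 1 y, E t / t) = I2 at *
    generalize (∫ t in Set.Ioc 1 y, E t / t ^ 2) = I3 at *
    have e : (Real.log y - 1) * (ρ * y + E y) - (ρ * (y - 1) + ρ * y * Real.log y + I2 + y * I3) +
        (2 * ρ + (I3 + I1)) * y = ρ + (Real.log y - 1) * E y - I2 + y * I1 := by ring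
    rw [e]
    rw [abs_le] at b1 b2 b3 ⊢
    constructor <;> linarith [b1.1, b1.2, b2.1, b2.2, b3.1, b3.2]

/-! ### Sums weighted by `oneModInv q` -/

theorem mod_eq_one_of_oneMod_ne_zero {q : ℕ} (hq : 2 ≤ q) {n : ℕ} (h : oneMod q n ≠ 0) :
    n % q = 1 := by
  induction n using induction_on_primes with
  | zero => simp at h
  | one => exact Nat.mod_eq_of_lt hq
  | prime_mul p a hp ih =>
    rw [oneMod_mul, oneMod_prime q hp] at h
    have h1 : p % q = 1 := by
      by_contra h1
      simp [h1] at h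
    rw [Nat.mul_mod, h1, ih (right_ne_zero_of_mul h), one_mul, Nat.mod_eq_of_lt hq]

theorem not_dvd_of_oneMod_ne_zero {q n p : ℕ} (hp : p.Prime) (hpq : p % q ≠ 1)
    (h : oneMod q n ≠ 0) : ¬ p ∣ n := by
  rintro ⟨m, rfl⟩
  rw [oneMod_mul, oneMod_prime q hp, if_neg hpq, zero_mul] at h
  exact h rfl

/-- A number built from primes `≡ 1 mod q` is `1 mod q` and prime to `6`, which leaves two classes
modulo `12`: `1, 7` for `q = 3` and `1, 5` for `q = 4`. The resulting density `1/6` keeps the later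
constants small. -/
theorem abs_oneModInv_le {q : ℕ} (hq : q = 3 ∨ q = 4) (n : ℕ) :
    |oneModInv q n| ≤ (if n % 12 = 1 then 1 else 0) + (if n % 12 = 13 - 2 * q then 1 else 0) := by
  by_cases h : oneMod q n = 0
  · rw [oneModInv, pmul_apply, h, zero_mul, abs_zero]
    positivity
  · have h1 : |oneModInv q n| ≤ 1 := by
      rw [oneModInv, pmul_apply, abs_mul, intCoe_apply]
      refine mul_le_one₀ ?_ (abs_nonneg _) ?_
      · simp only [oneMod, coe_mk]
        split_ifs <;> simp
      · exact_mod_cast abs_moebius_le_one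
    have h2 := mod_eq_one_of_oneMod_ne_zero (by omega) h
    have h3 := not_dvd_of_oneMod_ne_zero Nat.prime_two (by rcases hq with rfl | rfl <;> norm_num) h
    have h4 := not_dvd_of_oneMod_ne_zero Nat.prime_three
      (by rcases hq with rfl | rfl <;> norm_num) h
    have h5 : n % 12 = 1 ∨ n % 12 = 13 - 2 * q := by
      rcases hq with rfl | rfl <;> omega
    refine h1.trans ?_
    rcases h5 with h5 | h5
    · rw [if_pos h5]
      have : (0 : ℝ) ≤ if n % 12 = 13 - 2 * q then 1 else 0 := by positivity
      linarith
    · rw [if_pos h5]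
      have : (0 : ℝ) ≤ if n % 12 = 1 then 1 else 0 := by positivity
      linarith

theorem sum_class_eq {c : ℕ} (hc : 0 < c) (hc' : c < 12) (f : ℕ → ℝ) (N : ℕ) :
    ∑ n ∈ Ioc 0 N, (if n % 12 = c then f n else 0) =
      ∑ k ∈ range ((N + 12 - c) / 12), f (12 * k + c) := by
  rw [← sum_filter]
  refine sum_nbij' (fun n => n / 12) (fun k => 12 * k + c) ?_ ?_ ?_ ?_ ?_
  · intro n hn
    simp only [mem_filter, mem_Ioc, mem_range] at *
    omega
  · intro k hk
    simp only [mem_filter, mem_Ioc, mem_range] at *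
    omega
  · intro n hn
    simp only [mem_filter, mem_Ioc] at hn
    omega
  · intro k hk
    omega
  · intro n hn
    simp only [mem_filter, mem_Ioc] at hn
    congr 1
    omega

/-- Bernoulli's inequality at `-d/(a+d)`; it compares a term with the integral of `t^(-θ)` over the
preceding step, so that sums over a progression telescope. -/
theorem mul_rpow_neg_le {θ : ℝ} (h0 : 0 ≤ θ) (h1 : θ < 1) {a d : ℝ} (ha : 0 ≤ a) (hd : 0 < d) :
    (1 - θ) * d * (a + d) ^ (-θ) ≤ (a + d) ^ (1 - θ) - a ^ (1 - θ) := by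
  have hp : 0 < a + d := by linarith
  have hs : -1 ≤ -(d / (a + d)) := by
    rw [neg_le_neg_iff, div_le_one hp]
    linarith
  have h := rpow_one_add_le_one_add_mul_self hs (p := 1 - θ) (by linarith) (by linarith)
  have e1 : 1 + -(d / (a + d)) = a / (a + d) := by field_simp; ring
  rw [e1, Real.div_rpow ha hp.le, div_le_iff₀ (Real.rpow_pos_of_pos hp _)] at h
  have e2 : (a + d) ^ (-θ) * (a + d) = (a + d) ^ (1 - θ) := by
    nth_rw 2 [← Real.rpow_one (a + d)]
    rw [← Real.rpow_add hp]
    ring_nf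
  have e3 : (1 - θ) * (d / (a + d)) * (a + d) ^ (1 - θ) = (1 - θ) * d * (a + d) ^ (-θ) := by
    rw [← e2]
    field_simp
  linarith

theorem sum_class_rpow_le {θ : ℝ} (h0 : 0 ≤ θ) (h1 : θ < 1) {c : ℕ} (hc : 0 < c) (hc' : c < 12)
    (N : ℕ) : ∑ n ∈ Ioc 0 N, (if n % 12 = c then (n : ℝ) ^ (-θ) else 0) ≤
      1 + (N : ℝ) ^ (1 - θ) / (12 * (1 - θ)) := by
  rw [sum_class_eq hc hc' (fun n => (n : ℝ) ^ (-θ))]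
  have hθ : 0 < 12 * (1 - θ) := by linarith
  have key (K : ℕ) : ∑ k ∈ range (K + 1), ((12 * k + c : ℕ) : ℝ) ^ (-θ) ≤
      1 + ((12 * K + c : ℕ) : ℝ) ^ (1 - θ) / (12 * (1 - θ)) := by
    induction K with
    | zero =>
      have : (1 : ℝ) ≤ (12 * 0 + c : ℕ) := by exact_mod_cast (by omega)
      rw [sum_range_one]
      refine le_add_of_le_of_nonneg
        (Real.rpow_le_one_of_one_le_of_nonpos this (by linarith)) (by positivity)
    | succ K ih =>
      rw [sum_range_succ]
      have h := mul_rpow_neg_le h0 h1 (a := ((12 * K + c : ℕ) : ℝ)) (d := 12) (by positivity)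
        (by norm_num)
      have e : ((12 * K + c : ℕ) : ℝ) + 12 = ((12 * (K + 1) + c : ℕ) : ℝ) := by push_cast; ring
      rw [e, mul_comm (1 - θ) 12, mul_comm (12 * (1 - θ)), ← le_div_iff₀ hθ, sub_div] at h
      linarith
  rcases hK : (N + 12 - c) / 12 with _ | K
  · rw [sum_range_zero]
    positivity
  · refine (key K).trans ?_
    have : 12 * K + c ≤ N := by omega
    gcongr

theorem sum_abs_oneModInv_mul_rpow_le {q : ℕ} (hq : q = 3 ∨ q = 4) {θ : ℝ} (h0 : 0 ≤ θ)
    (h1 : θ < 1) {x : ℝ} (hx : 0 ≤ x) :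
    ∑ d ∈ Ioc 0 ⌊x⌋₊, |oneModInv q d| * (x / d) ^ θ ≤ 2 * x ^ θ + x / (6 * (1 - θ)) := by
  have hθ : 0 < 1 - θ := by linarith
  have hc : 0 < 13 - 2 * q ∧ 13 - 2 * q < 12 := by rcases hq with rfl | rfl <;> norm_num
  have hx' : (⌊x⌋₊ : ℝ) ^ (1 - θ) ≤ x ^ (1 - θ) := by
    gcongr
    exact Nat.floor_le hx
  have a1 := sum_class_rpow_le h0 h1 one_pos (by norm_num) ⌊x⌋₊
  have a2 := sum_class_rpow_le h0 h1 hc.1 hc.2 ⌊x⌋₊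
  have hx0 := Real.rpow_nonneg hx θ
  calc ∑ d ∈ Ioc 0 ⌊x⌋₊, |oneModInv q d| * (x / d) ^ θ
      ≤ ∑ d ∈ Ioc 0 ⌊x⌋₊, x ^ θ * ((if d % 12 = 1 then (d : ℝ) ^ (-θ) else 0) +
          (if d % 12 = 13 - 2 * q then (d : ℝ) ^ (-θ) else 0)) := by
        refine sum_le_sum fun d _ => ?_
        rw [Real.div_rpow hx (by positivity), div_eq_mul_inv, ← Real.rpow_neg (by positivity)]
        have h := mul_le_mul_of_nonneg_right (abs_oneModInv_le hq d)
          (by positivity : 0 ≤ x ^ θ * (d : ℝ) ^ (-θ))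
        refine h.trans_eq ?_
        split_ifs <;> ring
    _ ≤ x ^ θ * (2 * (1 + x ^ (1 - θ) / (12 * (1 - θ)))) := by
        rw [← mul_sum, sum_add_distrib]
        have : (⌊x⌋₊ : ℝ) ^ (1 - θ) / (12 * (1 - θ)) ≤ x ^ (1 - θ) / (12 * (1 - θ)) := by gcongr
        gcongr
        linarith
    _ = 2 * x ^ θ + x / (6 * (1 - θ)) := by
        rcases hx.eq_or_lt with rfl | hx
        · rcases h0.eq_or_lt with rfl | h0
          · simp
          · rw [Real.zero_rpow h0.ne']
            simp
        · have e : x ^ θ * x ^ (1 - θ) = x := by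
            rw [← Real.rpow_add hx]
            simp
          calc _ = 2 * x ^ θ + (x ^ θ * x ^ (1 - θ)) / (6 * (1 - θ)) := by field_simp; ring
            _ = _ := by rw [e]

theorem sum_mul_eq_sum_floor (f g : ArithmeticFunction ℝ) (x : ℝ) :
    ∑ n ∈ Ioc 0 ⌊x⌋₊, (f * g) n = ∑ d ∈ Ioc 0 ⌊x⌋₊, f d * ∑ m ∈ Ioc 0 ⌊x / d⌋₊, g m := by
  rw [sum_Ioc_mul_eq_sum_sum]
  simp_rw [Nat.floor_div_natCast]

/-- With floors, the sum counts integers having no prime factor `≡ 1 mod q`, hence lies in `[0, x]`,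
at distance at most `x/2` from `x/2`. Removing the floors costs at most `∑ |oneModInv q d| ≤ 2 +
x/6`. -/
theorem abs_sum_oneModInv_mul_div_le {q : ℕ} (hq : q = 3 ∨ q = 4) {x : ℝ} (hx : 0 ≤ x) :
    |∑ d ∈ Ioc 0 ⌊x⌋₊, oneModInv q d * (x / d) - x / 2| ≤ 2 / 3 * x + 2 := by
  have h1 : ∑ n ∈ Ioc 0 ⌊x⌋₊, (oneModInv q * (ζ : ArithmeticFunction ℝ)) n =
      ∑ d ∈ Ioc 0 ⌊x⌋₊, oneModInv q d * ⌊x / d⌋₊ := by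
    rw [sum_Ioc_mul_zeta_eq_sum]
    simp_rw [Nat.floor_div_natCast]
  have h2 : 0 ≤ ∑ n ∈ Ioc 0 ⌊x⌋₊, (oneModInv q * (ζ : ArithmeticFunction ℝ)) n ∧
      ∑ n ∈ Ioc 0 ⌊x⌋₊, (oneModInv q * (ζ : ArithmeticFunction ℝ)) n ≤ x := by
    rw [mul_comm]
    refine ⟨sum_nonneg fun n _ => (zeta_mul_oneModInv_mem q n).1, ?_⟩
    refine (sum_le_card_nsmul _ _ 1 fun n _ => (zeta_mul_oneModInv_mem q n).2).trans ?_
    simpa using Nat.floor_le hx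
  have h3 : |∑ d ∈ Ioc 0 ⌊x⌋₊, oneModInv q d * (x / d) -
      ∑ d ∈ Ioc 0 ⌊x⌋₊, oneModInv q d * ⌊x / d⌋₊| ≤ 2 + x / 6 := by
    rw [← sum_sub_distrib]
    refine (abs_sum_le_sum_abs _ _).trans ?_
    have := sum_abs_oneModInv_mul_rpow_le hq (θ := 0) le_rfl one_pos hx
    simp only [Real.rpow_zero, mul_one, sub_zero] at this
    refine le_trans (sum_le_sum fun d _ => ?_) this
    rw [← mul_sub, abs_mul]
    refine mul_le_of_le_one_right (abs_nonneg _) ?_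
    have a1 := Nat.floor_le (by positivity : 0 ≤ x / d)
    have a2 := (Nat.sub_one_lt_floor (x / d)).le
    rw [abs_le]
    constructor <;> linarith
  rw [h1] at h2
  rw [abs_le] at h3 ⊢
  constructor <;> linarith [h2.1, h2.2, h3.1, h3.2]

/-! ### Elementary upper bounds for the counting function -/

theorem chi_nonneg_of_evenInd_ne_zero {q : ℕ} (hq : q = 3 ∨ q = 4) {n : ℕ}
    (h : evenInd q n ≠ 0) : 0 ≤ chi q n := by
  rcases eq_or_ne n 0 with rfl | hn
  · simp
  rw [evenInd_eq hq hn] at h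
  have h' : ∀ p ∈ n.primeFactors, p % q = q - 1 → Even (n.factorization p) := by
    by_contra h'
    rw [if_neg h'] at h
    exact h rfl
  rw [(isMultiplicative_of_map_mul (chi_one hq) (chi_mul hq)).multiplicative_factorization _ hn,
    Finsupp.prod, Nat.support_factorization]
  refine prod_nonneg fun p hp => ?_
  rw [chi_pow hq, chi_apply (Nat.prime_of_mem_primeFactors hp).ne_zero]
  split_ifs with h1 h2
  · simp
  · rw [(h' p hp h2).neg_one_pow]
    norm_num
  · positivity

theorem evenInd_eq_zero_of_mod {q : ℕ} (hq : q = 3 ∨ q = 4) {n : ℕ} (h : n % q = q - 1) :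
    evenInd q n = 0 := by
  by_contra h0
  have h1 := chi_nonneg_of_evenInd_ne_zero hq h0
  have hn : n ≠ 0 := by
    rintro rfl
    simp at h0
  rw [chi_apply hn, if_neg (by omega), if_pos h] at h1
  linarith

/-- The class `-1 mod q` contains no represented integer, since inert primes enter only to even
powers; its density `1/q` is at least `1/4`. -/
theorem sum_evenInd_le {q : ℕ} (hq : q = 3 ∨ q = 4) (N : ℕ) :
    ∑ n ∈ Ioc 0 N, evenInd q n ≤ 3 / 4 * N + 1 := by
  have key : ∑ n ∈ Ioc 0 N, evenInd q n + ((N + 1) / q : ℕ) ≤ N := by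
    induction N with
    | zero =>
      rw [Nat.div_eq_of_lt (by omega)]
      simp
    | succ N ih =>
      rw [sum_Ioc_succ_top (by omega)]
      by_cases h : (N + 1) % q = q - 1
      · rw [evenInd_eq_zero_of_mod hq h]
        have : (N + 1 + 1) / q = (N + 1) / q + 1 := by
          rcases hq with rfl | rfl <;> omega
        rw [this]
        push_cast
        linarith
      · have : (N + 1 + 1) / q = (N + 1) / q := by
          rcases hq with rfl | rfl <;> omega
        rw [this]
        have := (evenInd_mem hq (N + 1)).2
        push_cast
        linarith
  have h : (N : ℝ) ≤ 4 * ((N + 1) / q : ℕ) + 4 := by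
    have : N ≤ 4 * ((N + 1) / q) + 4 := by rcases hq with rfl | rfl <;> omega
    exact_mod_cast this
  linarith

theorem sum_evenInd_floor_le {q : ℕ} (hq : q = 3 ∨ q = 4) {t : ℝ} (ht : 0 ≤ t) :
    ∑ n ∈ Ioc 0 ⌊t⌋₊, evenInd q n ≤ 3 / 4 * t + 1 := by
  refine (sum_evenInd_le hq _).trans ?_
  have := Nat.floor_le ht
  linarith

theorem sum_evenInd_floor_le_self {q : ℕ} (hq : q = 3 ∨ q = 4) {t : ℝ} (ht : 0 ≤ t) :
    ∑ n ∈ Ioc 0 ⌊t⌋₊, evenInd q n ≤ t := by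
  refine (sum_le_card_nsmul _ _ 1 fun n _ => (evenInd_mem hq n).2).trans ?_
  simpa using Nat.floor_le ht

theorem sum_evenInd_nonneg {q : ℕ} (hq : q = 3 ∨ q = 4) (N : ℕ) :
    0 ≤ ∑ n ∈ Ioc 0 N, evenInd q n :=
  sum_nonneg fun n _ => (evenInd_mem hq n).1

/-! ### The numerical kernel estimate -/

/-- For `z = y^(1/4)`, the tangent to `log` at `e^(5/4)` gives `log z ≤ z/e^(5/4) + 1/4`. This point
makes the constant cancel in `4 log z - 1`, and `4 / 3.4783` is about `1.15`. -/
theorem abs_log_sub_one_le {y : ℝ} (hy : 1 ≤ y) : |Real.log y - 1| ≤ 1.15 * y ^ (1 / 4 : ℝ) := by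
  have hy0 : 0 < y := by linarith
  set z := y ^ (1 / 4 : ℝ) with hz
  have hz1 : 1 ≤ z := Real.one_le_rpow hy (by norm_num)
  have hlog : Real.log y = 4 * Real.log z := by rw [hz, Real.log_rpow hy0]; ring
  have hlog0 : 0 ≤ Real.log y := Real.log_nonneg hy
  have hk : (3.4783 : ℝ) ≤ Real.exp (5 / 4) := by
    refine le_of_pow_le_pow_left₀ (n := 4) (by norm_num) (Real.exp_pos _).le ?_
    rw [← Real.exp_nat_mul, show ((4 : ℕ) : ℝ) * (5 / 4) = (5 : ℕ) * 1 by norm_num,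
      Real.exp_nat_mul]
    calc (3.4783 : ℝ) ^ 4 ≤ 2.7182 ^ 5 := by norm_num
      _ ≤ _ := by
        have := Real.exp_one_gt_d9
        gcongr
        linarith
  have h1 : Real.log z - 5 / 4 ≤ z * 0.2875 - 1 := by
    have h2 := Real.log_le_sub_one_of_pos (show 0 < z / Real.exp (5 / 4) by positivity)
    rw [Real.log_div (by positivity) (by positivity), Real.log_exp] at h2
    have : z / Real.exp (5 / 4) ≤ z * 0.2875 := by
      rw [div_le_iff₀ (Real.exp_pos _), mul_assoc]
      exact le_mul_of_one_le_right (by linarith) (by linarith)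
    linarith
  rw [abs_le]
  constructor
  · linarith
  · rw [hlog]
    linarith

theorem log_le_sqrt {y : ℝ} (hy : 1 ≤ y) : Real.log y ≤ √y := by
  have hy0 : 0 < √y := Real.sqrt_pos.2 (by linarith)
  have h := Real.log_le_sub_one_of_pos (show 0 < √y / Real.exp 1 by positivity)
  rw [Real.log_div (by positivity) (by positivity), Real.log_exp, Real.log_sqrt (by linarith)] at h
  have h2 : √y / Real.exp 1 ≤ √y / 2 := by
    have := Real.exp_one_gt_d9
    gcongr
    linarith
  linarith

/-- The error in `∑ reps` is `c₀ √t + 3/4` with `c₀ = 2/√q ≤ 1.1548`. Then `1.33` bounds `1.1548 ·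
1.15`, and `6.12` bounds `4 · 1.1548 + 2 · 3/4`. The bound `4.33` for `c` is nearly attained at `q =
4`, where `2ρ + 2c₀ + 3/4 = π/2 + 2.75`. -/
theorem exists_kernel_bound {q : ℕ} (hq : q = 3 ∨ q = 4) : ∃ c : ℝ, |c| ≤ 4.33 ∧ ∀ y, 1 ≤ y →
    |∑ n ∈ Ioc 0 ⌊y⌋₊, reps q n * (Real.log n - y / n) + c * y| ≤
      1.33 * y ^ (3 / 4 : ℝ) + 6.12 * y ^ (1 / 2 : ℝ) := by
  have h3 : (1.732 : ℝ) < √3 := Real.lt_sqrt_of_sq_lt (by norm_num)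
  obtain ⟨c₀, hc₀, hc₁, hc₂, hρ⟩ : ∃ c₀ : ℝ, c₀ = 2 / √q ∧ 1 ≤ c₀ ∧ c₀ ≤ 1.1548 ∧ 0 ≤ rho q ∧
      2 * rho q + 2 * c₀ + 3 / 4 ≤ 4.33 := by
    refine ⟨2 / √q, rfl, ?_⟩
    have hpi := Real.pi_lt_d4
    have hpi0 := Real.pi_pos
    rcases hq with rfl | rfl
    · rw [rho_three]
      have h4 : √3 ≤ 2 := by
        rw [Real.sqrt_le_left (by norm_num)]
        norm_num
      have h5 : 2 / √(3 : ℕ) ≤ 1.1548 := by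
        rw [div_le_iff₀ (by positivity)]
        push_cast
        linarith
      have h6 : Real.pi / (3 * √3) ≤ 0.605 := by
        rw [div_le_iff₀ (by positivity)]
        linarith
      refine ⟨?_, h5, by positivity, by linarith⟩
      rw [le_div_iff₀ (by positivity)]
      push_cast
      linarith
    · rw [rho_four]
      have h4 : √(4 : ℕ) = 2 := by
        rw [show ((4 : ℕ) : ℝ) = 2 ^ 2 by norm_num]
        exact Real.sqrt_sq (by norm_num)
      rw [h4]
      exact ⟨by norm_num, by norm_num, by positivity, by linarith⟩
  have hR : ∀ t, 1 ≤ t → |∑ n ∈ Ioc 0 ⌊t⌋₊, reps q n - rho q * t| ≤ c₀ * √t + 3 / 4 := by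
    intro t ht
    refine (abs_sum_reps_sub_le_sqrt hq ht).trans ?_
    rw [Real.sqrt_div (by linarith), hc₀, div_mul_eq_mul_div, mul_div_assoc]
    have : (1 : ℝ) / 4 ≤ 1 / q := by rcases hq with rfl | rfl <;> norm_num
    linarith
  obtain ⟨c, h1, h2⟩ := exists_sum_mul_log_sub_div (f := reps q) (by simp) hρ.1 hR
  refine ⟨c, h1.trans hρ.2, fun y hy => (h2 y hy).trans ?_⟩
  have hy0 : 0 < y := by linarith
  have a1 := abs_log_sub_one_le hy
  have a2 := log_le_sqrt hy
  have a3 := Real.log_nonneg hy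
  have a4 : 1 ≤ √y := Real.one_le_sqrt.2 hy
  have a5 : |Real.log y - 1| + Real.log y + 1 ≤ 2 * √y := by
    rcases abs_cases (Real.log y - 1) with ⟨h, _⟩ | ⟨h, _⟩ <;> rw [h] <;> linarith
  have a6 : y ^ (3 / 4 : ℝ) = √y * y ^ (1 / 4 : ℝ) := by
    rw [Real.sqrt_eq_rpow, ← Real.rpow_add hy0]
    norm_num
  rw [← Real.sqrt_eq_rpow, a6]
  have a7 : rho q ≤ 2 * c₀ := by linarith [hρ.2]
  have a8 : c₀ * √y * |Real.log y - 1| ≤ 1.1548 * √y * (1.15 * y ^ (1 / 4 : ℝ)) := by gcongr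
  have a9 : 0 ≤ √y * y ^ (1 / 4 : ℝ) := by positivity
  have a10 : c₀ * √y ≤ 1.1548 * √y := by gcongr
  nlinarith

/-! ### The relation between `∑ b(n)` and `∑ b(n)/n` -/

theorem sum_evenInd_mul_log (q : ℕ) (x : ℝ) :
    ∑ n ∈ Ioc 0 ⌊x⌋₊, evenInd q n * Real.log n =
      Real.log x * ∑ n ∈ Ioc 0 ⌊x⌋₊, evenInd q n -
        ∫ t in Set.Ioc 1 x, t⁻¹ * ∑ n ∈ Ioc 0 ⌊t⌋₊, evenInd q n := by
  have h := sum_mul_eq_sub_integral_mul₀ (f := Real.log) (evenInd q) (by simp) x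
    (fun t ht => Real.differentiableAt_log (by linarith [ht.1])) ?_
  · rw [sum_Icc_zero_eq (f := fun k : ℕ => Real.log k * evenInd q k) (by simp),
      sum_Icc_zero_eq (by simp)] at h
    simp_rw [mul_comm (evenInd q _)]
    rw [h]
    congr 1
    refine setIntegral_congr_fun measurableSet_Ioc fun t ht => ?_
    rw [sum_Icc_zero_eq (by simp), Real.deriv_log]
  · rw [Real.deriv_log']
    refine ContinuousOn.integrableOn_Icc (continuousOn_inv₀.mono fun t ht => ?_)
    simp only [Set.mem_compl_iff, Set.mem_singleton_iff]
    linarith [ht.1]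

theorem integral_inv_mul_sum_mem {q : ℕ} (hq : q = 3 ∨ q = 4) {x : ℝ} (hx : 1 ≤ x) :
    0 ≤ ∫ t in Set.Ioc 1 x, t⁻¹ * ∑ n ∈ Ioc 0 ⌊t⌋₊, evenInd q n ∧
      ∫ t in Set.Ioc 1 x, t⁻¹ * ∑ n ∈ Ioc 0 ⌊t⌋₊, evenInd q n ≤ 3 / 4 * x + Real.log x := by
  constructor
  · refine setIntegral_nonneg measurableSet_Ioc fun t ht => ?_
    have := sum_evenInd_nonneg hq ⌊t⌋₊
    have : 0 < t := by linarith [ht.1]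
    positivity
  · have hi2 : IntervalIntegrable (fun t : ℝ => t⁻¹) volume 1 x := by
      refine intervalIntegral.intervalIntegrable_inv (fun t ht => ?_) continuousOn_id
      rw [Set.uIcc_of_le hx] at ht
      linarith [ht.1]
    have hi1 : IntervalIntegrable (fun _ : ℝ => (3 / 4 : ℝ)) volume 1 x := by simp
    have hi := (intervalIntegrable_iff_integrableOn_Ioc_of_le hx).1 (hi1.add hi2)
    have h : ∫ t in Set.Ioc 1 x, t⁻¹ * ∑ n ∈ Ioc 0 ⌊t⌋₊, evenInd q n ≤
        ∫ t in Set.Ioc 1 x, (3 / 4 + t⁻¹) := by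
      refine integral_mono_of_nonneg ?_ hi ?_
      · refine (ae_restrict_iff' measurableSet_Ioc).2 (Eventually.of_forall fun t ht => ?_)
        have := sum_evenInd_nonneg hq ⌊t⌋₊
        have : 0 < t := by linarith [ht.1]
        simp only [Pi.zero_apply]
        positivity
      · refine (ae_restrict_iff' measurableSet_Ioc).2 (Eventually.of_forall fun t ht => ?_)
        have h0 : 0 < t := by linarith [ht.1]
        have := mul_le_mul_of_nonneg_left (sum_evenInd_floor_le hq h0.le) (inv_nonneg.2 h0.le)
        refine this.trans_eq ?_
        field_simp
    rw [← intervalIntegral.integral_of_le hx, ← intervalIntegral.integral_of_le hx,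
      intervalIntegral.integral_add hi1 hi2, integral_inv_of_pos one_pos (by linarith),
      intervalIntegral.integral_const, div_one, smul_eq_mul] at h
    rw [← intervalIntegral.integral_of_le hx]
    linarith

/-- The weight `1/n` is completely multiplicative, so the factorisation `evenInd q = reps q *
oneModInv q` survives it. This is what lets the `y/m` half of the kernel reassemble into `∑ b(n)/n`.
-/
theorem mul_sum_evenInd_div (q : ℕ) {x : ℝ} :
    x * ∑ n ∈ Ioc 0 ⌊x⌋₊, evenInd q n / n =
      ∑ d ∈ Ioc 0 ⌊x⌋₊, oneModInv q d * ∑ m ∈ Ioc 0 ⌊x / d⌋₊, reps q m * ((x / d) / m) := by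
  let ι : ArithmeticFunction ℝ := ⟨fun n => (n : ℝ)⁻¹, by simp⟩
  have hι : ∀ m n, ι (m * n) = ι m * ι n := fun m n => by
    simp only [ι, coe_mk, Nat.cast_mul, mul_inv]
  have h := sum_mul_eq_sum_floor (ι.pmul (oneModInv q)) (ι.pmul (reps q)) x
  rw [← pmul_mul_distrib hι, mul_comm (oneModInv q)] at h
  have h1 (n : ℕ) : evenInd q n / n = (ι.pmul (reps q * oneModInv q)) n := by
    rw [pmul_apply, evenInd, div_eq_mul_inv, mul_comm]
    rfl
  simp_rw [h1]
  rw [h, mul_sum]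
  refine sum_congr rfl fun d _ => ?_
  rw [pmul_apply, mul_sum, mul_sum, mul_sum]
  refine sum_congr rfl fun m _ => ?_
  rw [pmul_apply]
  simp only [ι, coe_mk]
  ring

theorem two_mul_sum_evenInd_mul_log {q : ℕ} (hq : q = 3 ∨ q = 4) (x : ℝ) :
    2 * ∑ n ∈ Ioc 0 ⌊x⌋₊, evenInd q n * Real.log n =
      (∑ d ∈ Ioc 0 ⌊x⌋₊, oneModInv q d * ∑ m ∈ Ioc 0 ⌊x / d⌋₊, reps q m * Real.log m) +
      ∑ d ∈ Ioc 0 ⌊x⌋₊, lam q d * ∑ m ∈ Ioc 0 ⌊x / d⌋₊, evenInd q m := by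
  have h := sum_mul_eq_sum_floor (oneModInv q) ((reps q).pmul log) x
  simp only [pmul_apply, log_apply] at h
  rw [← h, ← sum_mul_eq_sum_floor, ← sum_add_distrib, mul_sum]
  refine sum_congr rfl fun n _ => ?_
  rw [← ArithmeticFunction.add_apply, ← two_mul_evenInd_pmul_log hq, two_mul, two_mul,
    ArithmeticFunction.add_apply, pmul_apply, log_apply]

theorem sum_lam_mul_mem {q : ℕ} (hq : q = 3 ∨ q = 4) {x : ℝ} (hx : 0 ≤ x) :
    0 ≤ ∑ d ∈ Ioc 0 ⌊x⌋₊, lam q d * ∑ m ∈ Ioc 0 ⌊x / d⌋₊, evenInd q m ∧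
      ∑ d ∈ Ioc 0 ⌊x⌋₊, lam q d * ∑ m ∈ Ioc 0 ⌊x / d⌋₊, evenInd q m ≤ 2.684 * x := by
  constructor
  · exact sum_nonneg fun d _ => mul_nonneg (lam_nonneg hq d) (sum_evenInd_nonneg hq _)
  · calc ∑ d ∈ Ioc 0 ⌊x⌋₊, lam q d * ∑ m ∈ Ioc 0 ⌊x / d⌋₊, evenInd q m
        ≤ ∑ d ∈ Ioc 0 ⌊x⌋₊, lam q d / d * x := by
          refine sum_le_sum fun d _ => ?_
          have := mul_le_mul_of_nonneg_left
            (sum_evenInd_floor_le_self hq (by positivity : 0 ≤ x / d)) (lam_nonneg hq d)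
          refine this.trans_eq ?_
          ring
      _ ≤ _ := by
          rw [← sum_mul]
          exact mul_le_mul_of_nonneg_right (sum_lam_div_le hq _) hx

/-- The quantity `2 log x ∑ b n - x ∑ b n / n + ∑ b n`, divided by `x`, stays in an interval of
length `17.06`. -/
theorem exists_mem_interval {q : ℕ} (hq : q = 3 ∨ q = 4) : ∃ m : ℝ, ∀ x, Real.exp 12.5 ≤ x →
    m * x ≤ 2 * Real.log x * ∑ n ∈ Ioc 0 ⌊x⌋₊, evenInd q n -
      x * ∑ n ∈ Ioc 0 ⌊x⌋₊, evenInd q n / n + ∑ n ∈ Ioc 0 ⌊x⌋₊, evenInd q n ∧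
    2 * Real.log x * ∑ n ∈ Ioc 0 ⌊x⌋₊, evenInd q n -
      x * ∑ n ∈ Ioc 0 ⌊x⌋₊, evenInd q n / n + ∑ n ∈ Ioc 0 ⌊x⌋₊, evenInd q n
      ≤ (m + 17.06) * x := by
  obtain ⟨c, hc, hK⟩ := exists_kernel_bound hq
  -- The two-sided errors total `1.33 · 2/3 + 6.12 / 3 + 4.33 · 2/3` plus lower-order terms, below
  -- `5.96`. The nonnegative terms only push upwards, by about `0.75 + 1.5 + 2.684`, which fits in
  -- the length `17.06`.
  refine ⟨-(c / 2) - 5.96, fun x hx => ?_⟩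
  obtain ⟨z, hz, hz1⟩ : ∃ z : ℝ, x ^ (1 / 4 : ℝ) = z ∧ 22.7 ≤ z := by
    refine ⟨_, rfl, ?_⟩
    have h1 : Real.exp 12.5 ^ (1 / 4 : ℝ) ≤ x ^ (1 / 4 : ℝ) := by gcongr
    refine le_trans ?_ h1
    rw [← Real.exp_mul]
    -- The claim is `22.7 ≤ e^(25/8)`; the eighth power reduces it to a rational bound for `e`.
    refine le_of_pow_le_pow_left₀ (n := 8) (by norm_num) (Real.exp_pos _).le ?_
    rw [← Real.exp_nat_mul, show ((8 : ℕ) : ℝ) * (12.5 * (1 / 4)) = (25 : ℕ) * 1 by norm_num,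
      Real.exp_nat_mul]
    calc (22.7 : ℝ) ^ 8 ≤ 2.7182 ^ 25 := by norm_num
      _ ≤ _ := by
        have := Real.exp_one_gt_d9
        gcongr
        linarith
  have hx0 : 0 < x := lt_of_lt_of_le (Real.exp_pos _) hx
  have hx1 : 1 ≤ x := le_trans (Real.one_le_exp (by norm_num)) hx
  have hlogz : Real.log x ≤ 4 * z := by
    have h1 : Real.log x = 4 * Real.log z := by rw [← hz, Real.log_rpow hx0]; ring
    have h2 := Real.log_le_sub_one_of_pos (show 0 < z by linarith)
    linarith
  have hx34 : x ^ (3 / 4 : ℝ) = z ^ 3 := by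
    rw [← hz, ← Real.rpow_natCast, ← Real.rpow_mul hx0.le]
    norm_num
  have hx12 : x ^ (1 / 2 : ℝ) = z ^ 2 := by
    rw [← hz, ← Real.rpow_natCast, ← Real.rpow_mul hx0.le]
    norm_num
  have hxz : x = z ^ 4 := by
    rw [← hz, ← Real.rpow_natCast, ← Real.rpow_mul hx0.le]
    norm_num
  have e1 := sum_evenInd_mul_log q x
  have e2 := two_mul_sum_evenInd_mul_log hq x
  have e3 := mul_sum_evenInd_div q (x := x)
  have b1 := integral_inv_mul_sum_mem hq hx1
  have b2 := sum_lam_mul_mem hq hx0.le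
  have b3 := sum_evenInd_nonneg hq ⌊x⌋₊
  have b4 := sum_evenInd_floor_le hq hx0.le
  have b5 := abs_sum_oneModInv_mul_div_le hq hx0.le
  -- Adding `c x/d` inside turns each inner sum into the small kernel error; the compensating sum is
  -- known up to `O(x)` around `x/2`.
  have hsum : (∑ d ∈ Ioc 0 ⌊x⌋₊, oneModInv q d * ∑ m ∈ Ioc 0 ⌊x / d⌋₊, reps q m * Real.log m) -
      ∑ d ∈ Ioc 0 ⌊x⌋₊, oneModInv q d * ∑ m ∈ Ioc 0 ⌊x / d⌋₊, reps q m * ((x / d) / m) =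
      ∑ d ∈ Ioc 0 ⌊x⌋₊, oneModInv q d * (∑ m ∈ Ioc 0 ⌊x / d⌋₊,
        reps q m * (Real.log m - (x / d) / m) + c * (x / d)) -
      c * ∑ d ∈ Ioc 0 ⌊x⌋₊, oneModInv q d * (x / d) := by
    rw [mul_sum, ← sum_sub_distrib, ← sum_sub_distrib]
    refine sum_congr rfl fun d _ => ?_
    simp only [mul_sub, sum_sub_distrib]
    ring
  have b6 : |∑ d ∈ Ioc 0 ⌊x⌋₊, oneModInv q d * (∑ m ∈ Ioc 0 ⌊x / d⌋₊,
        reps q m * (Real.log m - (x / d) / m) + c * (x / d))| ≤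
      1.33 * (2 * z ^ 3 + 2 / 3 * x) + 6.12 * (2 * z ^ 2 + 1 / 3 * x) := by
    have t1 := sum_abs_oneModInv_mul_rpow_le hq (θ := 3 / 4) (by norm_num) (by norm_num) hx0.le
    have t2 := sum_abs_oneModInv_mul_rpow_le hq (θ := 1 / 2) (by norm_num) (by norm_num) hx0.le
    rw [hx34] at t1
    rw [hx12] at t2
    calc _ ≤ ∑ d ∈ Ioc 0 ⌊x⌋₊, (1.33 * (|oneModInv q d| * (x / d) ^ (3 / 4 : ℝ)) +
          6.12 * (|oneModInv q d| * (x / d) ^ (1 / 2 : ℝ))) := by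
          refine (abs_sum_le_sum_abs _ _).trans (sum_le_sum fun d hd => ?_)
          rw [mem_Ioc] at hd
          have hd1 : 1 ≤ x / d := by
            have : (0 : ℝ) < d := by exact_mod_cast hd.1
            rw [le_div_iff₀ this, one_mul]
            exact (Nat.le_floor_iff hx0.le).1 hd.2
          rw [abs_mul]
          refine (mul_le_mul_of_nonneg_left (hK _ hd1) (abs_nonneg _)).trans_eq ?_
          ring
      _ ≤ _ := by
          rw [sum_add_distrib, ← mul_sum, ← mul_sum]
          gcongr
          · refine t1.trans_eq ?_
            ring
          · refine t2.trans_eq ?_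
            ring
  have b7 : |c * (∑ d ∈ Ioc 0 ⌊x⌋₊, oneModInv q d * (x / d) - x / 2)| ≤
      4.33 * (2 / 3 * x + 2) := by
    rw [abs_mul]
    gcongr
  have hz3 : z ^ 3 * 22.7 ≤ x := by
    rw [hxz, pow_succ z 3]
    gcongr
  have hz2 : z ^ 2 * 515 ≤ x := by
    rw [hxz, show z ^ 4 = z ^ 2 * z ^ 2 by ring]
    gcongr
    nlinarith
  have hz0 : z * 11600 ≤ x := by
    nlinarith
  generalize (∑ n ∈ Ioc 0 ⌊x⌋₊, evenInd q n / n) = s at *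
  generalize (∑ n ∈ Ioc 0 ⌊x⌋₊, evenInd q n * Real.log n) = l at *
  generalize (∑ n ∈ Ioc 0 ⌊x⌋₊, evenInd q n) = β at *
  generalize (∫ t in Set.Ioc 1 x, t⁻¹ * ∑ n ∈ Ioc 0 ⌊t⌋₊, evenInd q n) = I at *
  generalize (∑ d ∈ Ioc 0 ⌊x⌋₊, oneModInv q d * (x / d)) = u at *
  generalize (∑ d ∈ Ioc 0 ⌊x⌋₊, lam q d * ∑ m ∈ Ioc 0 ⌊x / d⌋₊, evenInd q m) = v at *
  generalize (∑ d ∈ Ioc 0 ⌊x⌋₊, oneModInv q d * ∑ m ∈ Ioc 0 ⌊x / d⌋₊, reps q m * Real.log m) = w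
    at *
  generalize (∑ d ∈ Ioc 0 ⌊x⌋₊,
    oneModInv q d * ∑ m ∈ Ioc 0 ⌊x / d⌋₊, reps q m * ((x / d) / m)) = w' at *
  generalize (∑ d ∈ Ioc 0 ⌊x⌋₊, oneModInv q d * (∑ m ∈ Ioc 0 ⌊x / d⌋₊,
        reps q m * (Real.log m - (x / d) / m) + c * (x / d))) = w'' at *
  have e4 : 2 * Real.log x * β - x * s + β =
      β + 2 * I + v + w'' - c * (u - x / 2) - c / 2 * x := by
    linear_combination (-2) * e1 + e2 - e3 + hsum
  rw [e4]
  rw [abs_le] at b6 b7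
  constructor <;> linarith [b1.1, b1.2, b2.1, b2.2, b6.1, b6.2, b7.1, b7.2]

/-! ### Solving the differential inequality -/

theorem hasDerivWithinAt_add_div_sqrt {f : ℝ → ℝ} {f' u : ℝ} (hu : 0 < u)
    (hf : HasDerivWithinAt f f' (Set.Ici u) u) (M : ℝ) :
    HasDerivWithinAt (fun v => (f v + M) / √v) ((2 * u * f' - f u - M) / (2 * u * √u))
      (Set.Ici u) u := by
  have hs : 0 < √u := Real.sqrt_pos.2 hu
  have h := (hf.add_const M).div (Real.hasDerivAt_sqrt hu.ne').hasDerivWithinAt hs.ne'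
  refine h.congr_deriv ?_
  have h2 : √u ^ 2 = u := Real.sq_sqrt hu.le
  rw [div_eq_div_iff (by positivity) (by positivity)]
  field_simp
  rw [h2]
  ring

/-- A continuous function `f` for which `2 u f'(u) - f(u)` is bounded is asymptotic to a multiple
of the square root. -/
theorem exists_sqrt_asymptotic {f f' : ℝ → ℝ} {u₀ m M : ℝ} (hu₀ : 0 < u₀)
    (hc : ∀ a b, ContinuousOn f (Set.Icc a b))
    (hd : ∀ u, HasDerivWithinAt f (f' u) (Set.Ici u) u)
    (hm : ∀ u, u₀ ≤ u → m ≤ 2 * u * f' u - f u) (hM : ∀ u, u₀ ≤ u → 2 * u * f' u - f u ≤ M) :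
    ∃ A : ℝ, ∀ u, u₀ ≤ u → A * √u - M ≤ f u ∧ f u ≤ A * √u - m := by
  have hcont (c : ℝ) {u v : ℝ} (hu : u₀ ≤ u) :
      ContinuousOn (fun v => (f v + c) / √v) (Set.Icc u v) :=
    ((hc u v).add continuousOn_const).div Real.continuous_sqrt.continuousOn fun t ht =>
      (Real.sqrt_pos.2 (by linarith [ht.1])).ne'
  -- The derivative of the quotient has the sign of `2tf' - f - M ≤ 0`. Only right derivatives are
  -- available, hence the comparison theorem for continuous functions with one-sided derivatives.
  have hanti {u v : ℝ} (hu : u₀ ≤ u) (huv : u ≤ v) : (f v + M) / √v ≤ (f u + M) / √u := by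
    refine image_le_of_deriv_right_le_deriv_boundary (hcont M hu (v := v))
      (fun t ht => hasDerivWithinAt_add_div_sqrt (by linarith [ht.1]) (hd t) M)
      (B := fun _ => (f u + M) / √u) (B' := fun _ => 0) le_rfl continuousOn_const
      (fun t _ => hasDerivWithinAt_const _ _ _) (fun t ht => ?_) (Set.right_mem_Icc.2 huv)
    have h0 : 0 < t := by linarith [ht.1]
    exact div_nonpos_of_nonpos_of_nonneg (by linarith [hM t (by linarith [ht.1])]) (by positivity)
  have hmono {u v : ℝ} (hu : u₀ ≤ u) (huv : u ≤ v) : (f u + m) / √u ≤ (f v + m) / √v := by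
    have h := image_le_of_deriv_right_le_deriv_boundary (hcont m hu (v := v)).neg
      (fun t ht => (hasDerivWithinAt_add_div_sqrt (by linarith [ht.1]) (hd t) m).neg)
      (B := fun _ => -((f u + m) / √u)) (B' := fun _ => 0) le_rfl continuousOn_const
      (fun t _ => hasDerivWithinAt_const _ _ _) (fun t ht => ?_) (Set.right_mem_Icc.2 huv)
    · exact neg_le_neg_iff.1 h
    · have h0 : 0 < t := by linarith [ht.1]
      exact neg_nonpos.2 (div_nonneg (by linarith [hm t (by linarith [ht.1])]) (by positivity))
  have hle {u : ℝ} (hu : u₀ ≤ u) : (f u + m) / √u ≤ (f u + M) / √u := by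
    have := hm u hu
    have := hM u hu
    gcongr
    linarith
  have hbound {u v : ℝ} (hu : u₀ ≤ u) (hv : u₀ ≤ v) : (f u + m) / √u ≤ (f v + M) / √v := by
    rcases le_total u v with h | h
    · exact (hmono hu h).trans (hle hv)
    · exact (hle hu).trans (hanti hv h)
  -- Every lower quotient is at most every upper one, so this supremum separates the two families.
  refine ⟨sSup ((fun u => (f u + m) / √u) '' Set.Ici u₀), fun u hu => ?_⟩
  have hs : 0 < √u := Real.sqrt_pos.2 (by linarith)
  have h1 : (f u + m) / √u ≤ sSup ((fun u => (f u + m) / √u) '' Set.Ici u₀) := by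
    refine le_csSup ⟨(f u₀ + M) / √u₀, ?_⟩ ⟨u, hu, rfl⟩
    rintro _ ⟨v, hv, rfl⟩
    exact hbound hv le_rfl
  have h2 : sSup ((fun u => (f u + m) / √u) '' Set.Ici u₀) ≤ (f u + M) / √u := by
    refine csSup_le ⟨_, u, hu, rfl⟩ ?_
    rintro _ ⟨v, hv, rfl⟩
    exact hbound hv hu
  rw [div_le_iff₀ hs] at h1
  rw [le_div_iff₀ hs] at h2
  constructor <;> linarith

/-- A new term enters the sum with weight `0`. Thus the range can be fixed at the right endpoint if
each weight is replaced by its positive part. -/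
theorem continuousOn_sum_floor_exp (f : ℕ → ℝ) (a c : ℝ) :
    ContinuousOn (fun u => ∑ n ∈ Ioc 0 ⌊Real.exp u⌋₊, f n * (1 / n - Real.exp (-u)))
      (Set.Icc a c) := by
  have h : ContinuousOn (fun u => ∑ n ∈ Ioc 0 ⌊Real.exp c⌋₊, f n * max 0 (1 / n - Real.exp (-u)))
      (Set.Icc a c) := by
    refine Continuous.continuousOn ?_
    fun_prop
  refine h.congr fun u hu => ?_
  refine sum_subset_zero_on_sdiff (Ioc_subset_Ioc_right ?_) ?_ ?_
  · exact Nat.floor_le_floor (Real.exp_le_exp.2 hu.2)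
  · intro n hn
    rw [Finset.mem_sdiff, mem_Ioc, mem_Ioc] at hn
    have hn1 : Real.exp u < n := by
      by_contra h
      exact hn.2 ⟨hn.1.1, Nat.le_floor (not_lt.1 h)⟩
    rw [max_eq_left, mul_zero]
    rw [sub_nonpos, Real.exp_neg, ← one_div]
    exact one_div_le_one_div_of_le (Real.exp_pos _) hn1.le
  · intro n hn
    rw [mem_Ioc] at hn
    have hn1 : (n : ℝ) ≤ Real.exp u := (Nat.le_floor_iff (Real.exp_pos _).le).1 hn.2
    have hn0 : (0 : ℝ) < n := by exact_mod_cast hn.1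
    rw [max_eq_right]
    rw [sub_nonneg, Real.exp_neg, ← one_div]
    exact one_div_le_one_div_of_le hn0 hn1

/-- Immediately to the right of `u` the floor of `e^v` does not change, so the sum can be
differentiated termwise. On the left this fails when `e^u` is an integer. -/
theorem hasDerivWithinAt_sum_floor_exp (f : ℕ → ℝ) (u : ℝ) :
    HasDerivWithinAt (fun u => ∑ n ∈ Ioc 0 ⌊Real.exp u⌋₊, f n * (1 / n - Real.exp (-u)))
      (Real.exp (-u) * ∑ n ∈ Ioc 0 ⌊Real.exp u⌋₊, f n) (Set.Ici u) u := by
  have h : HasDerivWithinAt (fun v => ∑ n ∈ Ioc 0 ⌊Real.exp u⌋₊, f n * (1 / n - Real.exp (-v)))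
      (Real.exp (-u) * ∑ n ∈ Ioc 0 ⌊Real.exp u⌋₊, f n) (Set.Ici u) u := by
    rw [mul_sum]
    refine HasDerivWithinAt.fun_sum fun n _ => ?_
    have h1 : HasDerivAt (fun v => Real.exp (-v)) (-Real.exp (-u)) u := by
      simpa using (hasDerivAt_neg u).exp
    refine ((h1.const_sub (1 / (n : ℝ))).const_mul (f n)).hasDerivWithinAt.congr_deriv ?_
    ring
  refine h.congr_of_eventuallyEq ?_ rfl
  have h2 : Real.exp u < ⌊Real.exp u⌋₊ + 1 := Nat.lt_floor_add_one _
  have h3 : ∀ᶠ v in 𝓝[≥] u, Real.exp v < ⌊Real.exp u⌋₊ + 1 :=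
    nhdsWithin_le_nhds (Real.continuous_exp.continuousAt.eventually (gt_mem_nhds h2))
  filter_upwards [h3, self_mem_nhdsWithin] with v hv huv
  have : ⌊Real.exp v⌋₊ = ⌊Real.exp u⌋₊ := by
    refine le_antisymm (Nat.le_of_lt_succ ?_) (Nat.floor_le_floor (Real.exp_le_exp.2 huv))
    rw [Nat.floor_lt (Real.exp_pos _).le]
    exact_mod_cast hv
  rw [this]

/-- Both `2uf' - f` and `A√u - f` lie in `[m, m + 17.06]`, so `2uf'` is within `17.06` of `A√u`;
dividing by `2u` gives `8.53`. For the second bound, `∑ b(n)/n` exceeds `f` by `B(x)/x`, which lies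
in `[0, 1]`. -/
theorem exists_asymptotic {q : ℕ} (hq : q = 3 ∨ q = 4) : ∃ A K : ℝ, ∀ x, Real.exp 12.5 ≤ x →
    |∑ n ∈ Ioc 0 ⌊x⌋₊, evenInd q n - A / 2 * (x / √(Real.log x))| ≤ 8.53 * (x / Real.log x) ∧
    |∑ n ∈ Ioc 0 ⌊x⌋₊, evenInd q n / n - A * √(Real.log x)| ≤ K := by
  obtain ⟨m, hm⟩ := exists_mem_interval hq
  have hY (u : ℝ) : ∑ n ∈ Ioc 0 ⌊Real.exp u⌋₊, evenInd q n * (1 / n - Real.exp (-u)) =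
      ∑ n ∈ Ioc 0 ⌊Real.exp u⌋₊, evenInd q n / n -
        Real.exp (-u) * ∑ n ∈ Ioc 0 ⌊Real.exp u⌋₊, evenInd q n := by
    rw [mul_sum, ← sum_sub_distrib]
    exact sum_congr rfl fun n _ => by ring
  have hΩ (u : ℝ) (hu : 12.5 ≤ u) :
      m ≤ 2 * u * (Real.exp (-u) * ∑ n ∈ Ioc 0 ⌊Real.exp u⌋₊, evenInd q n) -
        ∑ n ∈ Ioc 0 ⌊Real.exp u⌋₊, evenInd q n * (1 / n - Real.exp (-u)) ∧
      2 * u * (Real.exp (-u) * ∑ n ∈ Ioc 0 ⌊Real.exp u⌋₊, evenInd q n) -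
        ∑ n ∈ Ioc 0 ⌊Real.exp u⌋₊, evenInd q n * (1 / n - Real.exp (-u)) ≤ m + 17.06 := by
    have h := hm (Real.exp u) (Real.exp_le_exp.2 hu)
    rw [Real.log_exp] at h
    rw [hY, Real.exp_neg]
    have he := Real.exp_pos u
    generalize (∑ n ∈ Ioc 0 ⌊Real.exp u⌋₊, evenInd q n / n) = s at *
    generalize (∑ n ∈ Ioc 0 ⌊Real.exp u⌋₊, evenInd q n) = β at *
    have e : 2 * u * ((Real.exp u)⁻¹ * β) - (s - (Real.exp u)⁻¹ * β) =
        (2 * u * β - Real.exp u * s + β) / Real.exp u := by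
      field_simp
      ring
    rw [e, le_div_iff₀ he, div_le_iff₀ he]
    exact h
  obtain ⟨A, hA⟩ := exists_sqrt_asymptotic (u₀ := 12.5) (by norm_num)
    (continuousOn_sum_floor_exp (evenInd q)) (hasDerivWithinAt_sum_floor_exp (evenInd q))
    (fun u hu => (hΩ u hu).1) (fun u hu => (hΩ u hu).2)
  refine ⟨A, |m| + 19, fun x hx => ?_⟩
  have hx0 : 0 < x := lt_of_lt_of_le (Real.exp_pos _) hx
  have hL : 12.5 ≤ Real.log x := (Real.le_log_iff_exp_le hx0).2 hx
  have h1 := hA _ hL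
  have h2 := hΩ _ hL
  rw [hY, Real.exp_neg, Real.exp_log hx0] at h1 h2
  have h3 := sum_evenInd_nonneg hq ⌊x⌋₊
  have h4 := sum_evenInd_floor_le_self hq hx0.le
  generalize (∑ n ∈ Ioc 0 ⌊x⌋₊, evenInd q n / n) = s at *
  generalize (∑ n ∈ Ioc 0 ⌊x⌋₊, evenInd q n) = β at *
  generalize Real.log x = L at *
  have hL0 : 0 < L := by linarith
  have hs : √L * √L = L := Real.mul_self_sqrt hL0.le
  have hs0 : 0 < √L := Real.sqrt_pos.2 hL0
  constructor
  · have e : β - A / 2 * (x / √L) = x / L * ((2 * L * (x⁻¹ * β) - A * √L) / 2) := by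
      have e0 : x / √L = x / L * √L := by
        rw [div_mul_eq_mul_div, div_eq_div_iff hs0.ne' hL0.ne', mul_assoc, hs]
      rw [e0]
      field_simp
    rw [e, abs_mul, abs_of_pos (by positivity : 0 < x / L), mul_comm]
    refine mul_le_mul_of_nonneg_right ?_ (by positivity)
    rw [abs_le]
    constructor <;> linarith [h1.1, h1.2, h2.1, h2.2]
  · have h5 : 0 ≤ x⁻¹ * β := by positivity
    have h6 : x⁻¹ * β ≤ 1 := by
      rw [inv_mul_le_iff₀ hx0, mul_one]
      exact h4
    have h7 := neg_abs_le m
    have h8 := le_abs_self m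
    rw [abs_le]
    constructor <;> linarith [h1.1, h1.2]

/-! ### The Abelian theorem at `s = 1` -/

/-- Substituting `t = e^u` turns this into a Gamma integral, with `Γ(3/2) = √π / 2`. -/
theorem integral_sqrt_log_mul_rpow {δ : ℝ} (hδ : 0 < δ) :
    ∫ t in Set.Ioi (1 : ℝ), √(Real.log t) * t ^ (-(δ + 1)) =
      (1 / δ) ^ (3 / 2 : ℝ) * (√Real.pi / 2) := by
  have himg : Real.exp '' Set.Ioi 0 = Set.Ioi 1 := by
    ext y
    simp only [Set.mem_image, Set.mem_Ioi]
    constructor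
    · rintro ⟨x, hx, rfl⟩
      exact Real.one_lt_exp_iff.2 hx
    · intro hy
      exact ⟨Real.log y, Real.log_pos hy, Real.exp_log (by linarith)⟩
  have hG : Real.Gamma (3 / 2) = √Real.pi / 2 := by
    have := Real.Gamma_add_one (s := 1 / 2) (by norm_num)
    rw [Real.Gamma_one_half_eq] at this
    rw [show (3 / 2 : ℝ) = 1 / 2 + 1 by norm_num, this]
    ring
  rw [← himg, integral_image_eq_integral_abs_deriv_smul measurableSet_Ioi
    (fun x _ => (Real.hasDerivAt_exp x).hasDerivWithinAt) Real.exp_injective.injOn, ← hG,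
    ← Real.integral_rpow_mul_exp_neg_mul_Ioi (by norm_num) hδ]
  refine setIntegral_congr_fun measurableSet_Ioi fun u _ => ?_
  simp only [smul_eq_mul]
  rw [Real.log_exp, abs_of_pos (Real.exp_pos u), ← Real.exp_mul, Real.sqrt_eq_rpow,
    mul_left_comm, ← Real.exp_add]
  norm_num
  left
  ring

/-- The series of `f` at `1 + δ` is the series of `f n / n` at `δ`, whose partial sums grow slower
than any power of `x`; partial summation then applies. -/
theorem LSeries_one_add_eq {f : ℕ → ℝ} (hf : ∀ n, 0 ≤ f n) {A K : ℝ}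
    (h : ∀ x, 1 ≤ x → |∑ n ∈ Ioc 0 ⌊x⌋₊, f n / n - A * √(Real.log x)| ≤ K) {δ : ℝ} (hδ : 0 < δ) :
    LSeries (fun n => (f n : ℂ)) ((1 + δ : ℝ) : ℂ) =
      ((δ * ∫ t in Set.Ioi (1 : ℝ), (∑ n ∈ Ioc 0 ⌊t⌋₊, f n / n) * t ^ (-(δ + 1)) : ℝ) : ℂ) := by
  have h1 : LSeries (fun n => (f n : ℂ)) ((1 + δ : ℝ) : ℂ) =
      LSeries (fun n => ((f n / n : ℝ) : ℂ)) (δ : ℂ) := by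
    refine tsum_congr fun n => ?_
    rcases eq_or_ne n 0 with rfl | hn
    · simp
    · have hn' : (n : ℂ) ≠ 0 := by exact_mod_cast hn
      rw [LSeries.term_of_ne_zero hn, LSeries.term_of_ne_zero hn, Complex.ofReal_add,
        Complex.ofReal_one, Complex.cpow_add _ _ hn', Complex.cpow_one]
      push_cast
      rw [div_div]
  have hO : (fun n : ℕ => ∑ k ∈ Icc 1 n, f k / k) =O[atTop] fun n : ℕ => (n : ℝ) ^ (δ / 2) := by
    have h2 : (fun n : ℕ => ∑ k ∈ Icc 1 n, f k / k) =O[atTop]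
        fun n : ℕ => |A| * (Real.log n + 1) + K := by
      refine Asymptotics.IsBigO.of_bound 1 ?_
      filter_upwards [eventually_ge_atTop 1] with n hn
      have h3 := h n (by exact_mod_cast hn)
      rw [Nat.floor_natCast] at h3
      have h4 : 0 ≤ ∑ k ∈ Icc 1 n, f k / k :=
        sum_nonneg fun k _ => div_nonneg (hf k) (Nat.cast_nonneg k)
      have h5 : √(Real.log n) ≤ Real.log n + 1 := by
        rw [Real.sqrt_le_left (by linarith [Real.log_natCast_nonneg n])]
        nlinarith [Real.log_natCast_nonneg n]
      have h6 : A * √(Real.log n) ≤ |A| * (Real.log n + 1) := by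
        calc A * √(Real.log n) ≤ |A| * √(Real.log n) := by gcongr; exact le_abs_self A
          _ ≤ _ := by gcongr
      rw [one_mul, Real.norm_of_nonneg h4]
      refine le_trans ?_ (Real.le_norm_self _)
      have h7 := (abs_le.1 h3).2
      change ∑ k ∈ Icc (0 + 1) n, f k / k ≤ _
      rw [Icc_add_one_left_eq_Ioc]
      linarith
    refine h2.trans ?_
    have h3 : (fun n : ℕ => Real.log n) =O[atTop] fun n : ℕ => (n : ℝ) ^ (δ / 2) :=
      ((isLittleO_log_rpow_atTop (by positivity : 0 < δ / 2)).comp_tendsto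
        tendsto_natCast_atTop_atTop).isBigO
    have h4 (c : ℝ) : (fun _ : ℕ => c) =O[atTop] fun n : ℕ => (n : ℝ) ^ (δ / 2) := by
      refine Asymptotics.IsBigO.of_bound |c| ?_
      filter_upwards [eventually_ge_atTop 1] with n hn
      have : (1 : ℝ) ≤ (n : ℝ) ^ (δ / 2) :=
        Real.one_le_rpow (by exact_mod_cast hn) (by positivity)
      rw [Real.norm_of_nonneg (by linarith : (0 : ℝ) ≤ (n : ℝ) ^ (δ / 2)), Real.norm_eq_abs]
      exact le_mul_of_one_le_right (abs_nonneg c) this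
    exact ((h3.add (h4 1)).const_mul_left |A|).add (h4 K)
  rw [h1, LSeries_eq_mul_integral_of_nonneg (fun n => f n / n) (r := δ / 2) (by positivity)
    (by simpa using by linarith) hO (fun n => div_nonneg (hf n) (Nat.cast_nonneg n)),
    Complex.ofReal_mul, ← integral_complex_ofReal]
  congr 1
  refine setIntegral_congr_fun measurableSet_Ioi fun t ht => ?_
  have ht0 : 0 ≤ t := by linarith [Set.mem_Ioi.1 ht]
  change (∑ k ∈ Icc (0 + 1) ⌊t⌋₊, ((f k / k : ℝ) : ℂ)) * (t : ℂ) ^ (-((δ : ℂ) + 1)) = _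
  rw [Icc_add_one_left_eq_Ioc, Complex.ofReal_mul, Complex.ofReal_cpow ht0]
  push_cast
  rfl

/-- In the integral for the series, `A √(log t)` contributes `A √π / (2√δ)` exactly and the bounded
remainder contributes at most `K`. -/
theorem tendsto_sqrt_mul_LSeries {f : ℕ → ℝ} (hf : ∀ n, 0 ≤ f n) {A K : ℝ}
    (h : ∀ x, 1 ≤ x → |∑ n ∈ Ioc 0 ⌊x⌋₊, f n / n - A * √(Real.log x)| ≤ K) :
    Tendsto (fun δ : ℝ => (√δ : ℂ) * LSeries (fun n => (f n : ℂ)) ((1 + δ : ℝ) : ℂ)) (𝓝[>] 0)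
      (𝓝 ((A * (√Real.pi / 2) : ℝ) : ℂ)) := by
  set S : ℝ → ℝ := fun t => ∑ n ∈ Ioc 0 ⌊t⌋₊, f n / n with hS
  have hmS : Measurable S := measurable_sum_floor fun n => f n / n
  have hbound : ∀ δ : ℝ, 0 < δ →
      |√δ * (δ * ∫ t in Set.Ioi (1 : ℝ), S t * t ^ (-(δ + 1))) - A * (√Real.pi / 2)| ≤
        K * √δ := by
    intro δ hδ
    have hi1 : IntegrableOn (fun t : ℝ => √(Real.log t) * t ^ (-(δ + 1))) (Set.Ioi 1) := by
      refine Integrable.of_integral_ne_zero ?_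
      rw [integral_sqrt_log_mul_rpow hδ]
      positivity
    have hi2 : IntegrableOn (fun t : ℝ => K * t ^ (-(δ + 1))) (Set.Ioi 1) :=
      (integrableOn_Ioi_rpow_of_lt (by linarith) one_pos).const_mul K
    have hle : ∀ t ∈ Set.Ioi (1 : ℝ),
        ‖(S t - A * √(Real.log t)) * t ^ (-(δ + 1))‖ ≤ K * t ^ (-(δ + 1)) := by
      intro t ht
      have ht0 : 0 < t := by linarith [Set.mem_Ioi.1 ht]
      rw [norm_mul, Real.norm_of_nonneg (Real.rpow_nonneg ht0.le _)]
      exact mul_le_mul_of_nonneg_right (h t (le_of_lt ht)) (Real.rpow_nonneg ht0.le _)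
    have hae : ∀ᵐ t ∂(volume.restrict (Set.Ioi (1 : ℝ))),
        ‖(S t - A * √(Real.log t)) * t ^ (-(δ + 1))‖ ≤ K * t ^ (-(δ + 1)) :=
      (ae_restrict_iff' measurableSet_Ioi).2 (Eventually.of_forall hle)
    have hi3 : IntegrableOn (fun t : ℝ => (S t - A * √(Real.log t)) * t ^ (-(δ + 1)))
        (Set.Ioi 1) := by
      refine hi2.mono' ?_ hae
      exact ((hmS.sub (by fun_prop)).mul (by fun_prop)).aestronglyMeasurable
    have hsplit : ∫ t in Set.Ioi (1 : ℝ), S t * t ^ (-(δ + 1)) =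
        (∫ t in Set.Ioi (1 : ℝ), (S t - A * √(Real.log t)) * t ^ (-(δ + 1))) +
          A * ((1 / δ) ^ (3 / 2 : ℝ) * (√Real.pi / 2)) := by
      rw [← integral_sqrt_log_mul_rpow hδ, ← integral_const_mul,
        ← integral_add hi3 (hi1.const_mul A)]
      refine integral_congr_ae (Eventually.of_forall fun t => ?_)
      simp only
      ring
    have hR : |∫ t in Set.Ioi (1 : ℝ), (S t - A * √(Real.log t)) * t ^ (-(δ + 1))| ≤ K / δ := by
      have h1 := norm_integral_le_of_norm_le hi2 hae
      rw [integral_const_mul, integral_Ioi_rpow_of_lt (by linarith) one_pos] at h1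
      rw [← Real.norm_eq_abs]
      refine h1.trans_eq ?_
      rw [Real.one_rpow, show -(δ + 1) + 1 = -δ by ring, neg_div_neg_eq, mul_one_div]
    have e1 : √δ * (δ * (1 / δ) ^ (3 / 2 : ℝ)) = 1 := by
      rw [Real.sqrt_eq_rpow, one_div δ, Real.inv_rpow hδ.le, ← Real.rpow_neg hδ.le]
      nth_rw 2 [← Real.rpow_one δ]
      rw [← Real.rpow_add hδ, ← Real.rpow_add hδ]
      norm_num
    rw [hsplit]
    generalize (∫ t in Set.Ioi (1 : ℝ), (S t - A * √(Real.log t)) * t ^ (-(δ + 1))) = I at *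
    have e2 : √δ * (δ * (I + A * ((1 / δ) ^ (3 / 2 : ℝ) * (√Real.pi / 2)))) -
        A * (√Real.pi / 2) = √δ * (δ * I) := by
      linear_combination (A * (√Real.pi / 2)) * e1
    rw [e2, abs_mul, abs_mul, abs_of_pos hδ, abs_of_nonneg (Real.sqrt_nonneg δ), mul_comm]
    refine mul_le_mul_of_nonneg_right ?_ (Real.sqrt_nonneg δ)
    calc δ * |I| ≤ δ * (K / δ) := by gcongr
      _ = K := by field_simp
  have hlim : Tendsto (fun δ : ℝ => √δ * (δ * ∫ t in Set.Ioi (1 : ℝ), S t * t ^ (-(δ + 1))))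
      (𝓝[>] 0) (𝓝 (A * (√Real.pi / 2))) := by
    rw [tendsto_iff_norm_sub_tendsto_zero]
    have hK : Tendsto (fun δ : ℝ => K * √δ) (𝓝[>] 0) (𝓝 0) := by
      have : Tendsto (fun δ : ℝ => K * √δ) (𝓝 0) (𝓝 (K * √0)) :=
        (Real.continuous_sqrt.const_mul K).tendsto 0 |>.congr fun _ => rfl
      rw [Real.sqrt_zero, mul_zero] at this
      exact this.mono_left nhdsWithin_le_nhds
    refine squeeze_zero' (Eventually.of_forall fun _ => norm_nonneg _) ?_ hK
    filter_upwards [self_mem_nhdsWithin] with δ hδ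
    exact hbound δ hδ
  refine ((Complex.continuous_ofReal.tendsto _).comp hlim).congr' ?_
  filter_upwards [self_mem_nhdsWithin] with δ hδ
  rw [LSeries_one_add_eq hf h hδ, Function.comp, Complex.ofReal_mul]

/-! ### The square of the Dirichlet series and the constant `A` -/

/-- A real arithmetic function, seen as a complex one. -/
noncomputable def complexify (f : ArithmeticFunction ℝ) : ArithmeticFunction ℂ :=
  ⟨fun n => (f n : ℂ), by simp⟩

theorem complexify_apply (f : ArithmeticFunction ℝ) (n : ℕ) : complexify f n = (f n : ℂ) := rfl

theorem complexify_mul (f g : ArithmeticFunction ℝ) :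
    complexify (f * g) = complexify f * complexify g := by
  ext n
  simp [complexify_apply, mul_apply]

theorem reps_nonneg {q : ℕ} (hq : q = 3 ∨ q = 4) (n : ℕ) : 0 ≤ reps q n := by
  rcases eq_or_ne n 0 with rfl | hn
  · simp
  rw [(isMultiplicative_reps hq).multiplicative_factorization _ hn, Finsupp.prod,
    Nat.support_factorization]
  refine prod_nonneg fun p hp => ?_
  rw [reps_prime_pow hq (Nat.prime_of_mem_primeFactors hp),
    chi_apply (Nat.prime_of_mem_primeFactors hp).ne_zero]
  split_ifs
  · positivity
  · rw [neg_one_geom_sum]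
    split_ifs <;> norm_num
  · positivity

theorem sqQuot_mem {q : ℕ} (hq : q = 3 ∨ q = 4) (n : ℕ) : 0 ≤ sqQuot q n ∧ sqQuot q n ≤ 1 := by
  refine map_mem_unitInterval (isMultiplicative_sqQuot hq) (fun p k hp => ?_) n
  cases k with
  | zero => simp [(isMultiplicative_sqQuot hq).map_one]
  | succ k =>
    rw [sqQuot_prime_pow_succ hq hp]
    split_ifs <;> norm_num

theorem eq_mul_sq_of_sqQuot_ne_zero {q : ℕ} (hq : q = 3 ∨ q = 4) {n : ℕ} (h : sqQuot q n ≠ 0) :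
    ∃ a k : ℕ, ram q ^ a * k ^ 2 = n := by
  have hn : n ≠ 0 := by
    rintro rfl
    simp at h
  rw [(isMultiplicative_sqQuot hq).multiplicative_factorization _ hn, Finsupp.prod,
    Nat.support_factorization, prod_ne_zero_iff] at h
  have heven : ∀ p ∈ n.primeFactors, p ≠ ram q → Even (n.factorization p) := by
    intro p hp hpr
    have hpp := Nat.prime_of_mem_primeFactors hp
    have h0 := h p hp
    by_contra hodd
    rw [Nat.not_even_iff_odd] at hodd
    obtain ⟨j, hj⟩ := hodd
    rw [hj, sqQuot_prime_pow_succ hq hpp] at h0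
    have hor : p % q = 1 ∨ p % q = q - 1 := by
      by_contra hno
      push Not at hno
      exact hpr (eq_ram hq hpp hno.1 hno.2)
    rw [if_pos] at h0
    · exact h0 rfl
    · exact hor.imp id fun h1 => ⟨h1, j, rfl⟩
  refine ⟨if ram q ∈ n.primeFactors then n.factorization (ram q) else 0,
    ∏ p ∈ n.primeFactors.erase (ram q), p ^ (n.factorization p / 2), ?_⟩
  have h1 : (∏ p ∈ n.primeFactors.erase (ram q), p ^ (n.factorization p / 2)) ^ 2 =
      ∏ p ∈ n.primeFactors.erase (ram q), p ^ n.factorization p := by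
    rw [← prod_pow]
    refine prod_congr rfl fun p hp => ?_
    rw [mem_erase] at hp
    rw [← pow_mul, Nat.div_mul_cancel (heven p hp.2 hp.1).two_dvd]
  have h2 : ∏ p ∈ n.primeFactors, p ^ n.factorization p = n := by
    have := Nat.prod_factorization_pow_eq_self hn
    rwa [Finsupp.prod, Nat.support_factorization] at this
  rw [h1]
  split_ifs with h3
  · rw [mul_prod_erase _ (fun p => p ^ n.factorization p) h3, h2]
  · rw [erase_eq_of_notMem h3, pow_zero, one_mul, h2]

/-- The support injects into pairs `(a, k)` through `n = r^a k²`, so the series is dominated by a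
geometric series times `∑ 1/k²`. -/
theorem summable_sqQuot_div {q : ℕ} (hq : q = 3 ∨ q = 4) :
    Summable fun n : ℕ => sqQuot q n / n := by
  have hr : 2 ≤ ram q := by rcases hq with rfl | rfl <;> norm_num [ram]
  have hr' : (2 : ℝ) ≤ ram q := by exact_mod_cast hr
  have h1 : Summable fun x : ℕ × ℕ => (1 / (ram q : ℝ)) ^ x.1 * (1 / (x.2 : ℝ) ^ 2) := by
    have hs1 : Summable fun n : ℕ => (1 / (ram q : ℝ)) ^ n := by
      refine summable_geometric_of_lt_one (by positivity) ?_
      rw [div_lt_one (by linarith)]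
      linarith
    have hs2 : Summable fun n : ℕ => 1 / (n : ℝ) ^ 2 := Real.summable_one_div_nat_pow.2 one_lt_two
    have hn1 : 0 ≤ fun n : ℕ => (1 / (ram q : ℝ)) ^ n := fun n => by
      change 0 ≤ (1 / (ram q : ℝ)) ^ n
      positivity
    have hn2 : 0 ≤ fun n : ℕ => 1 / (n : ℝ) ^ 2 := fun n => by
      change 0 ≤ 1 / (n : ℝ) ^ 2
      positivity
    exact hs1.mul_of_nonneg hs2 hn1 hn2
  set T : Set ℕ := {n | sqQuot q n ≠ 0} with hT
  choose! a k hak using fun n (hn : n ∈ T) => eq_mul_sq_of_sqQuot_ne_zero hq hn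
  have hinj : Function.Injective fun n : T => (a n, k n) := by
    intro m n hmn
    simp only [Prod.mk.injEq] at hmn
    apply Subtype.ext
    rw [← hak m m.2, ← hak n n.2, hmn.1, hmn.2]
  have h2 := h1.comp_injective hinj
  have h3 : Summable (T.indicator fun n : ℕ => sqQuot q n / n) := by
    refine (summable_subtype_iff_indicator (f := fun n : ℕ => sqQuot q n / n)).1 ?_
    refine h2.of_nonneg_of_le
      (fun n => div_nonneg (sqQuot_mem hq n).1 (Nat.cast_nonneg _)) fun n => ?_
    have h4 : ((n : ℕ) : ℝ) = (ram q : ℝ) ^ a n * (k n : ℝ) ^ 2 := by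
      exact_mod_cast (hak n n.2).symm
    simp only [Function.comp]
    rw [h4, one_div_pow, one_div_mul_one_div]
    have := (sqQuot_mem hq n).2
    gcongr
  refine h3.congr fun n => ?_
  by_cases hn : n ∈ T
  · rw [Set.indicator_of_mem hn]
  · rw [Set.indicator_of_notMem hn]
    simp only [hT, Set.mem_ofPred_eq, not_not] at hn
    rw [hn, zero_div]

theorem tendsto_LSeries_sqQuot {q : ℕ} (hq : q = 3 ∨ q = 4) :
    Tendsto (fun δ : ℝ => LSeries (fun n => (sqQuot q n : ℂ)) ((1 + δ : ℝ) : ℂ)) (𝓝[>] 0)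
      (𝓝 ((∑' n : ℕ, sqQuot q n / n : ℝ) : ℂ)) := by
  have h1 : ((∑' n : ℕ, sqQuot q n / n : ℝ) : ℂ) =
      LSeries (fun n => (sqQuot q n : ℂ)) ((1 + 0 : ℝ) : ℂ) := by
    rw [Complex.ofReal_tsum]
    refine tsum_congr fun n => ?_
    rcases eq_or_ne n 0 with rfl | hn
    · simp
    · rw [LSeries.term_of_ne_zero hn]
      simp
  rw [h1]
  refine tendsto_tsum_of_dominated_convergence (summable_sqQuot_div hq) (fun n => ?_) ?_
  · rcases eq_or_ne n 0 with rfl | hn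
    · simp
    · simp_rw [LSeries.term_of_ne_zero hn]
      have hn' : (n : ℂ) ≠ 0 := by exact_mod_cast hn
      refine Tendsto.mono_left ?_ nhdsWithin_le_nhds
      refine ContinuousAt.tendsto (f := fun δ : ℝ => (sqQuot q n : ℂ) / (n : ℂ) ^ ((1 + δ : ℝ) : ℂ))
        (x := 0) ?_
      refine continuousAt_const.div ?_ ((Complex.cpow_ne_zero_iff).2 (Or.inl hn'))
      exact (continuousAt_const_cpow hn').comp (f := fun δ : ℝ => ((1 + δ : ℝ) : ℂ)) (by fun_prop)
  · filter_upwards [self_mem_nhdsWithin] with δ hδ n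
    rw [Set.mem_Ioi] at hδ
    rw [LSeries.norm_term_eq]
    split_ifs with hn
    · simp [hn]
    · rw [Complex.norm_real, Real.norm_of_nonneg (sqQuot_mem hq n).1, Complex.ofReal_re]
      have hn1 : (1 : ℝ) ≤ n := by exact_mod_cast Nat.one_le_iff_ne_zero.2 hn
      refine div_le_div_of_nonneg_left (sqQuot_mem hq n).1 (by linarith) ?_
      exact Real.self_le_rpow_of_one_le hn1 (by linarith)

/-- The mean value of `reps q` is `rho q`, and for a nonnegative function the mean value is the
limit of `(s - 1)` times the series at `1`. -/
theorem tendsto_mul_LSeries_reps {q : ℕ} (hq : q = 3 ∨ q = 4) :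
    Tendsto (fun δ : ℝ => (δ : ℂ) * LSeries (fun n => (reps q n : ℂ)) ((1 + δ : ℝ) : ℂ)) (𝓝[>] 0)
      (𝓝 (rho q : ℂ)) := by
  have hlim : Tendsto (fun n : ℕ => (∑ k ∈ Icc 1 n, reps q k) / (n : ℝ)) atTop (𝓝 (rho q)) := by
    have hb : ∀ n : ℕ, 1 ≤ n →
        |(∑ k ∈ Icc 1 n, reps q k) / (n : ℝ) - rho q| ≤ 3 * (√(n : ℝ))⁻¹ := by
      intro n hn
      have hn1 : (1 : ℝ) ≤ n := by exact_mod_cast hn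
      have h1 := abs_sum_reps_sub_le_sqrt hq hn1
      rw [Nat.floor_natCast] at h1
      have h2 : √((n : ℝ) / q) ≤ √n := by
        apply Real.sqrt_le_sqrt
        refine div_le_self (by positivity) ?_
        rcases hq with rfl | rfl <;> norm_num
      have h3 : 1 ≤ √(n : ℝ) := Real.one_le_sqrt.2 hn1
      have h4 : (0 : ℝ) ≤ 1 / q := by positivity
      have h5 : √(n : ℝ) * √(n : ℝ) = n := Real.mul_self_sqrt (by positivity)
      have h6 : Icc 1 n = Ioc 0 n := rfl
      have h7 : (∑ k ∈ Ioc 0 n, reps q k) / (n : ℝ) - rho q =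
          (∑ k ∈ Ioc 0 n, reps q k - rho q * n) / n := by field_simp
      have h8 : 3 * (√(n : ℝ))⁻¹ * n = 3 * √(n : ℝ) := by
        have : √(n : ℝ) ≠ 0 := by positivity
        field_simp
        linarith
      rw [h6, h7, abs_div, abs_of_pos (by linarith : (0 : ℝ) < n), div_le_iff₀ (by linarith), h8]
      linarith
    have h0 : Tendsto (fun n : ℕ => 3 * (√(n : ℝ))⁻¹) atTop (𝓝 (3 * 0)) :=
      (tendsto_inv_atTop_zero.comp
        (Real.tendsto_sqrt_atTop.comp tendsto_natCast_atTop_atTop)).const_mul (3 : ℝ)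
    rw [mul_zero] at h0
    rw [tendsto_iff_dist_tendsto_zero]
    refine squeeze_zero' (Eventually.of_forall fun _ => dist_nonneg) ?_ h0
    filter_upwards [eventually_ge_atTop 1] with n hn
    rw [Real.dist_eq]
    exact hb n hn
  have h := LSeries_tendsto_sub_mul_nhds_one_of_tendsto_sum_div_and_nonneg _ hlim (reps_nonneg hq)
  have hshift : Tendsto (fun δ : ℝ => 1 + δ) (𝓝[>] 0) (𝓝[>] 1) := by
    refine tendsto_nhdsWithin_iff.2 ⟨?_, ?_⟩
    · refine Tendsto.mono_left ?_ nhdsWithin_le_nhds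
      exact ((continuous_const.add continuous_id).tendsto' (0 : ℝ) 1 (by simp))
    · filter_upwards [self_mem_nhdsWithin] with δ hδ
      simpa using hδ
  refine (h.comp hshift).congr fun δ => ?_
  simp [Function.comp]

theorem LSeriesSummable_complexify {f : ArithmeticFunction ℝ} (hf : ∀ n, |f n| ≤ 1) {δ : ℝ}
    (hδ : 0 < δ) : LSeriesSummable (fun n => complexify f n) ((1 + δ : ℝ) : ℂ) :=
  LSeriesSummable_of_bounded_of_one_lt_real (m := 1)
    (fun n _ => by simpa [complexify] using hf n) (by linarith)

theorem LSeries_evenInd_sq {q : ℕ} (hq : q = 3 ∨ q = 4) {δ : ℝ} (hδ : 0 < δ) :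
    LSeries (fun n => (evenInd q n : ℂ)) ((1 + δ : ℝ) : ℂ) ^ 2 =
      LSeries (fun n => (reps q n : ℂ)) ((1 + δ : ℝ) : ℂ) *
        LSeries (fun n => (sqQuot q n : ℂ)) ((1 + δ : ℝ) : ℂ) := by
  have hb := LSeriesSummable_complexify (f := evenInd q) (fun n => abs_le.2
    ⟨by linarith [(evenInd_mem hq n).1], (evenInd_mem hq n).2⟩) hδ
  have hg := LSeriesSummable_complexify (f := sqQuot q) (fun n => abs_le.2
    ⟨by linarith [(sqQuot_mem hq n).1], (sqQuot_mem hq n).2⟩) hδ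
  have hz := LSeriesSummable_complexify (f := (ζ : ArithmeticFunction ℝ)) (fun n => by
    rw [natCoe_apply, zeta_apply]
    split_ifs <;> simp) hδ
  have hchi := LSeriesSummable_complexify (f := chi q) (fun n => by
    rcases eq_or_ne n 0 with rfl | hn
    · simp
    · rw [chi_apply hn]
      split_ifs <;> simp) hδ
  have hr : LSeriesSummable (fun n => complexify (reps q) n) ((1 + δ : ℝ) : ℂ) := by
    rw [reps, complexify_mul]
    exact LSeriesSummable_mul hz hchi
  have h1 := LSeries_mul' hb hb
  have h2 := LSeries_mul' hr hg
  rw [← complexify_mul, evenInd_mul_self, complexify_mul, h2] at h1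
  rw [sq]
  exact h1.symm

theorem sq_mul_pi_eq {q : ℕ} (hq : q = 3 ∨ q = 4) {A K : ℝ}
    (h : ∀ x, 1 ≤ x → |∑ n ∈ Ioc 0 ⌊x⌋₊, evenInd q n / n - A * √(Real.log x)| ≤ K) :
    A ^ 2 * Real.pi / 4 = rho q * ∑' n : ℕ, sqQuot q n / n := by
  have h1 := (tendsto_sqrt_mul_LSeries (fun n => (evenInd_mem hq n).1) h).pow 2
  have h2 := (tendsto_mul_LSeries_reps hq).mul (tendsto_LSeries_sqQuot hq)
  have h3 := tendsto_nhds_unique (h1.congr' ?_) h2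
  · have h4 : (A * (√Real.pi / 2)) ^ 2 = rho q * ∑' n : ℕ, sqQuot q n / n := by
      exact_mod_cast h3
    rw [← h4, mul_pow, div_pow, Real.sq_sqrt Real.pi_pos.le]
    ring
  · filter_upwards [self_mem_nhdsWithin] with δ hδ
    rw [Set.mem_Ioi] at hδ
    rw [mul_pow, LSeries_evenInd_sq hq hδ, ← Complex.ofReal_pow, Real.sq_sqrt hδ.le, mul_assoc]

/-! ### Euler products and bounds for the constants -/

/-- The product over the primes `p ≡ -1 mod q` in the Landau-Ramanujan constants. -/
noncomputable def inertProd (q : ℕ) : ℝ :=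
  ∏' p : PrimesMod q (q - 1), (1 - 1 / (p : ℝ) ^ 2) ^ (-(1 / 2) : ℝ)

theorem one_sub_one_div_sq_pos {n : ℕ} (hn : 2 ≤ n) : 0 < 1 - 1 / (n : ℝ) ^ 2 := by
  have h2 : (2 : ℝ) ≤ n := by exact_mod_cast hn
  rw [sub_pos, div_lt_one (by positivity)]
  nlinarith

theorem hasProd_inertProd_sq (q : ℕ) :
    HasProd (fun p : PrimesMod q (q - 1) => (1 - 1 / (p : ℝ) ^ 2)⁻¹) (inertProd q ^ 2) := by
  have h := (multipliable_factor q (q - 1)).hasProd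
  have h2 := h.mul h
  rw [← sq] at h2
  convert! h2 using 2 with p
  have hp := one_sub_one_div_sq_pos p.2.1.two_le
  rw [← Real.rpow_add hp, ← Real.rpow_neg_one]
  norm_num

theorem half_le_prod_Icc (N : ℕ) : 1 / 2 ≤ ∏ n ∈ Icc 2 (N + 1), (1 - 1 / (n : ℝ) ^ 2) := by
  have h : ∏ n ∈ Icc 2 (N + 1), (1 - 1 / (n : ℝ) ^ 2) = ((N : ℝ) + 2) / (2 * (N + 1)) := by
    induction N with
    | zero => norm_num
    | succ N ih =>
      rw [prod_Icc_succ_top (by omega), ih]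
      push_cast
      have : (N : ℝ) + 1 ≠ 0 := by positivity
      have : (N : ℝ) + 1 + 1 ≠ 0 := by positivity
      rw [one_sub_div (by positivity), div_mul_div_comm, div_eq_div_iff (by positivity)
        (by positivity)]
      ring
  rw [h, div_le_div_iff₀ (by norm_num) (by positivity)]
  linarith

theorem inertProd_nonneg (q : ℕ) : 0 ≤ inertProd q := by
  have h := (multipliable_factor q (q - 1)).hasProd
  refine ge_of_tendsto' h fun s => prod_nonneg fun p _ => ?_
  exact Real.rpow_nonneg (one_sub_one_div_sq_pos p.2.1.two_le).le _

/-- A finite set of primes lies in some `[2, N+1]`, where the full product of `1 - 1/n²` telescopes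
to at least `1/2`; discarding factors only increases it. This gives `landauConst q ≤ 1`. -/
theorem inertProd_sq_le (q : ℕ) : inertProd q ^ 2 ≤ 2 := by
  refine hasProd_le_of_prod_le (hasProd_inertProd_sq q) fun s => ?_
  rw [prod_inv_distrib]
  refine inv_le_of_inv_le₀ (by norm_num) ?_
  set t : Finset ℕ := s.map ⟨Subtype.val, Subtype.val_injective⟩ with ht
  have h1 : ∏ p ∈ s, (1 - 1 / (p : ℝ) ^ 2) = ∏ n ∈ t, (1 - 1 / (n : ℝ) ^ 2) := by
    rw [ht, prod_map]
    rfl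
  have h2 : t ⊆ Icc 2 (t.sup id + 1) := by
    intro n hn
    have h3 : n ≤ t.sup id := le_sup (f := id) hn
    rw [ht, Finset.mem_map] at hn
    obtain ⟨p, -, rfl⟩ := hn
    exact mem_Icc.2 ⟨p.2.1.two_le, h3.trans (Nat.le_succ _)⟩
  have h3 := half_le_prod_Icc (t.sup id)
  rw [← prod_sdiff h2] at h3
  have h4 : ∀ n ∈ Icc 2 (t.sup id + 1), 0 ≤ 1 - 1 / (n : ℝ) ^ 2 := fun n hn =>
    (one_sub_one_div_sq_pos (mem_Icc.1 hn).1).le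
  have h5 : ∏ n ∈ Icc 2 (t.sup id + 1) \ t, (1 - 1 / (n : ℝ) ^ 2) ≤ 1 := by
    refine prod_le_one (fun n hn => h4 n (mem_sdiff.1 hn).1) fun n _ => ?_
    have : 0 ≤ 1 / (n : ℝ) ^ 2 := by positivity
    linarith
  have h6 : 0 ≤ ∏ n ∈ t, (1 - 1 / (n : ℝ) ^ 2) := prod_nonneg fun n hn => h4 n (h2 hn)
  rw [h1]
  have := mul_le_mul_of_nonneg_right h5 h6
  rw [one_mul] at this
  rw [← one_div]
  exact h3.trans this

theorem sqQuot_prime_pow {q : ℕ} (hq : q = 3 ∨ q = 4) {p : ℕ} (hp : p.Prime) (e : ℕ) :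
    sqQuot q (p ^ e) =
      if p % q = 1 then (if e = 0 then 1 else 0)
      else if p % q = q - 1 then (if Even e then 1 else 0) else 1 := by
  cases e with
  | zero => simp [(isMultiplicative_sqQuot hq).map_one]
  | succ k =>
    rw [sqQuot_prime_pow_succ hq hp]
    by_cases h1 : p % q = 1
    · simp [h1]
    · by_cases h2 : p % q = q - 1
      · by_cases h3 : Even (k + 1)
        · rw [if_neg h1, if_pos h2, if_pos h3, if_neg]
          rintro (h4 | h4)
          · exact h1 h4
          · exact Nat.not_odd_iff_even.2 h3 h4.2
        · rw [if_neg h1, if_pos h2, if_neg h3, if_pos (Or.inr ⟨h2, Nat.not_even_iff_odd.1 h3⟩)]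
      · simp [h1, h2]

theorem tsum_sqQuot_prime_pow {q : ℕ} (hq : q = 3 ∨ q = 4) {p : ℕ} (hp : p.Prime) :
    ∑' e : ℕ, sqQuot q (p ^ e) / ((p ^ e : ℕ) : ℝ) =
      if p % q = 1 then 1 else if p % q = q - 1 then (1 - 1 / (p : ℝ) ^ 2)⁻¹
      else (1 - 1 / (p : ℝ))⁻¹ := by
  have hp2 : (2 : ℝ) ≤ p := by exact_mod_cast hp.two_le
  have hp0 : 0 < 1 / (p : ℝ) := by positivity
  have hp1 : 1 / (p : ℝ) < 1 := by
    rw [div_lt_one (by linarith)]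
    linarith
  simp_rw [sqQuot_prime_pow hq hp, Nat.cast_pow]
  split_ifs with h1 h2
  · rw [tsum_eq_single 0 (fun e he => by simp [he])]
    simp
  · have hsum : HasSum (fun e : ℕ => (1 / (p : ℝ) ^ 2) ^ e) (1 - 1 / (p : ℝ) ^ 2)⁻¹ := by
      refine hasSum_geometric_of_lt_one (by positivity) ?_
      linarith [one_sub_one_div_sq_pos hp.two_le]
    have hinj : Function.Injective fun e : ℕ => 2 * e := fun a b h => by
      simpa using h
    have heq : ((fun e : ℕ => (if Even e then 1 else 0) / (p : ℝ) ^ e) ∘ fun e : ℕ => 2 * e) =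
        fun e : ℕ => (1 / (p : ℝ) ^ 2) ^ e := by
      ext e
      simp [pow_mul]
    rw [← heq, hinj.hasSum_iff] at hsum
    · exact hsum.tsum_eq
    · intro e he
      rw [if_neg, zero_div]
      rintro ⟨j, hj⟩
      exact he ⟨j, by simp only; omega⟩
  · simp_rw [← one_div_pow]
    exact tsum_geometric_of_lt_one hp0.le hp1

theorem hasProd_inertProd_sq_primes (q : ℕ) :
    HasProd (fun p : Nat.Primes => if (p : ℕ) % q = q - 1 then (1 - 1 / (p : ℝ) ^ 2)⁻¹ else 1)
      (inertProd q ^ 2) := by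
  have hinj : Function.Injective fun p : PrimesMod q (q - 1) => (⟨p.1, p.2.1⟩ : Nat.Primes) :=
    fun a b h => Subtype.ext (congrArg (fun x : Nat.Primes => (x : ℕ)) h)
  refine (hinj.hasProd_iff fun p hp => ?_).1 ?_
  · refine if_neg fun h => hp ⟨⟨p.1, p.2, h⟩, rfl⟩
  · convert! hasProd_inertProd_sq q using 2 with p
    exact if_pos p.2.2

/-- Euler product: the local factor is trivial at split primes, a geometric series in `p^(-2)` at
inert primes, and one in `p^(-1)` at the ramified prime. -/
theorem tsum_sqQuot_div {q : ℕ} (hq : q = 3 ∨ q = 4) :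
    ∑' n : ℕ, sqQuot q n / n = inertProd q ^ 2 * (1 - 1 / (ram q : ℝ))⁻¹ := by
  have hram : (ram q).Prime := by
    rcases hq with rfl | rfl <;> norm_num [ram]
  have hram' : ram q % q ≠ 1 ∧ ram q % q ≠ q - 1 := by
    rcases hq with rfl | rfl <;> norm_num [ram]
  have h1 := EulerProduct.eulerProduct_hasProd (f := fun n : ℕ => sqQuot q n / n)
    (by simp [(isMultiplicative_sqQuot hq).map_one])
    (fun {m n} hmn => by
      rw [(isMultiplicative_sqQuot hq).map_mul_of_coprime hmn, Nat.cast_mul, mul_div_mul_comm])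
    (summable_sqQuot_div hq).norm (by simp)
  have h0 : HasProd (fun p : Nat.Primes => if (p : ℕ) = ram q then (1 - 1 / (ram q : ℝ))⁻¹ else 1)
      (1 - 1 / (ram q : ℝ))⁻¹ := by
    have := hasProd_single (f := fun p : Nat.Primes =>
      if (p : ℕ) = ram q then (1 - 1 / (ram q : ℝ))⁻¹ else 1) ⟨ram q, hram⟩
      fun p hp => if_neg fun h => hp (Subtype.ext h)
    simpa using this
  have h2 := (hasProd_inertProd_sq_primes q).mul h0
  refine h1.unique (h2.congr_fun ?_)
  intro p
  rw [tsum_sqQuot_prime_pow hq p.2]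
  by_cases h3 : (p : ℕ) = ram q
  · rw [if_pos h3, h3, if_neg hram'.1, if_neg hram'.2, if_neg hram'.2, one_mul]
  · rw [if_neg h3, mul_one]
    have hne : q - 1 ≠ 1 := by omega
    split_ifs with h5 h6 h6
    · omega
    · rfl
    · rfl
    · exact absurd (eq_ram hq p.2 h5 h6) h3

/-- The asymptotic constant of the sum of `evenInd q`. -/
noncomputable def landauConst (q : ℕ) : ℝ :=
  1 / √2 * (if q = 3 then 1 / (3 : ℝ) ^ (1 / 4 : ℝ) else 1) * inertProd q

theorem landauConst_nonneg (q : ℕ) : 0 ≤ landauConst q := by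
  have := inertProd_nonneg q
  rw [landauConst]
  split_ifs <;> positivity

theorem landauConst_sq {q : ℕ} (hq : q = 3 ∨ q = 4) :
    landauConst q ^ 2 = rho q * (inertProd q ^ 2 * (1 - 1 / (ram q : ℝ))⁻¹) / Real.pi := by
  have hs : (1 / √2) ^ 2 = (1 / 2 : ℝ) := by
    rw [div_pow, Real.sq_sqrt (by norm_num)]
    norm_num
  rw [landauConst, mul_pow, mul_pow, hs]
  have hpi := Real.pi_pos
  rcases hq with rfl | rfl
  · have h3 : ((3 : ℝ) ^ (1 / 4 : ℝ)) ^ 2 = √3 := by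
      rw [← Real.rpow_natCast, ← Real.rpow_mul (by norm_num), Real.sqrt_eq_rpow]
      norm_num
    have : √(3 : ℝ) ≠ 0 := by positivity
    rw [rho_three, if_pos rfl, div_pow, h3, ram, if_pos rfl]
    field_simp
    ring
  · rw [rho_four, if_neg (by norm_num), ram, if_neg (by norm_num)]
    field_simp
    ring

theorem one_le_inertProd (q : ℕ) : 1 ≤ inertProd q := by
  refine ge_of_tendsto' (multipliable_factor q (q - 1)).hasProd fun s => ?_
  refine Finset.one_le_prod fun p _ => ?_
  refine Real.one_le_rpow_of_pos_of_le_one_of_nonpos (one_sub_one_div_sq_pos p.2.1.two_le) ?_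
    (by norm_num)
  have : 0 ≤ 1 / ((p : ℕ) : ℝ) ^ 2 := by positivity
  linarith

theorem half_le_landauConst (q : ℕ) : 1 / 2 ≤ landauConst q := by
  have hs : √(2 : ℝ) * √2 = 2 := Real.mul_self_sqrt (by norm_num)
  have h1 : (3 : ℝ) ^ (1 / 4 : ℝ) ≤ √2 := by
    refine Real.le_sqrt_of_sq_le ?_
    rw [← Real.rpow_natCast, ← Real.rpow_mul (by norm_num)]
    rw [show (1 / 4 : ℝ) * (2 : ℕ) = 1 / 2 by norm_num, ← Real.sqrt_eq_rpow, Real.sqrt_le_iff]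
    norm_num
  have h2 : 1 / √2 ≤ if q = 3 then 1 / (3 : ℝ) ^ (1 / 4 : ℝ) else 1 := by
    split_ifs
    · gcongr
    · rw [div_le_one (by positivity)]
      exact Real.one_le_sqrt.2 (by norm_num)
  rw [landauConst]
  calc (1 / 2 : ℝ) = 1 / √2 * (1 / √2) * 1 := by rw [one_div_mul_one_div, hs, mul_one]
    _ ≤ _ := by
      have := one_le_inertProd q
      gcongr

theorem landauConst_le_one {q : ℕ} : landauConst q ≤ 1 := by
  have h1 := inertProd_sq_le q
  have h2 := inertProd_nonneg q
  have h3 : (if q = 3 then 1 / (3 : ℝ) ^ (1 / 4 : ℝ) else 1) ≤ 1 := by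
    split_ifs
    · rw [div_le_one (by positivity)]
      exact Real.one_le_rpow (by norm_num) (by norm_num)
    · exact le_rfl
  have h4 : inertProd q ≤ √2 := Real.le_sqrt_of_sq_le h1
  rw [landauConst]
  calc _ ≤ 1 / √2 * 1 * √2 := by gcongr
    _ = 1 := by
      have : √(2 : ℝ) ≠ 0 := by positivity
      field_simp

/-! ### The estimate for `evenInd q` on the whole range `x ≥ 2` -/

theorem exists_abs_sub_le_of_one_le {q : ℕ} (hq : q = 3 ∨ q = 4) {A K X : ℝ}
    (h : ∀ x, X ≤ x → |∑ n ∈ Ioc 0 ⌊x⌋₊, evenInd q n / n - A * √(Real.log x)| ≤ K) :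
    ∃ K', ∀ x, 1 ≤ x → |∑ n ∈ Ioc 0 ⌊x⌋₊, evenInd q n / n - A * √(Real.log x)| ≤ K' := by
  have hnn (n : ℕ) : 0 ≤ evenInd q n / n := div_nonneg (evenInd_mem hq n).1 (Nat.cast_nonneg _)
  refine ⟨max K (∑ n ∈ Ioc 0 ⌊X⌋₊, evenInd q n / n + |A| * √(Real.log X)), fun x hx => ?_⟩
  rcases le_total X x with h1 | h1
  · exact (h x h1).trans (le_max_left _ _)
  · refine le_trans ?_ (le_max_right _ _)
    refine (abs_sub _ _).trans (add_le_add ?_ ?_)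
    · rw [abs_of_nonneg (sum_nonneg fun n _ => hnn n)]
      exact sum_le_sum_of_subset_of_nonneg
        (Ioc_subset_Ioc_right (Nat.floor_le_floor h1)) fun n _ _ => hnn n
    · rw [abs_mul, abs_of_nonneg (Real.sqrt_nonneg _)]
      gcongr

/-- If `A < 0`, at `log x = ((K+1)/A)²` the main term equals `-(K+1)`, which would make a
nonnegative sum at most `-1`. The sign is needed because the series identity only determines `A²`.
-/
theorem asymptotic_const_nonneg {q : ℕ} (hq : q = 3 ∨ q = 4) {A K : ℝ}
    (h : ∀ x, 1 ≤ x → |∑ n ∈ Ioc 0 ⌊x⌋₊, evenInd q n / n - A * √(Real.log x)| ≤ K) : 0 ≤ A := by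
  by_contra! hA
  have h1 := h (Real.exp (((K + 1) / A) ^ 2)) (Real.one_le_exp (sq_nonneg _))
  have hnn : 0 ≤ ∑ n ∈ Ioc 0 ⌊Real.exp (((K + 1) / A) ^ 2)⌋₊, evenInd q n / n :=
    sum_nonneg fun n _ => div_nonneg (evenInd_mem hq n).1 (Nat.cast_nonneg _)
  rw [Real.log_exp, Real.sqrt_sq_eq_abs] at h1
  have hK : 0 ≤ K := (abs_nonneg _).trans (h 1 le_rfl)
  have hK1 : |K + 1| = K + 1 := abs_of_pos (by linarith)
  rw [abs_div, abs_of_neg hA, hK1, div_neg, mul_neg, mul_div_cancel₀ _ hA.ne, abs_le] at h1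
  linarith [h1.2]

theorem abs_sum_evenInd_sub_le_of_exp_le {q : ℕ} (hq : q = 3 ∨ q = 4) {x : ℝ}
    (hx : Real.exp 12.5 ≤ x) :
    |∑ n ∈ Ioc 0 ⌊x⌋₊, evenInd q n - landauConst q * (x / √(Real.log x))| ≤
      8.53 * (x / Real.log x) := by
  obtain ⟨A, K, h⟩ := exists_asymptotic hq
  obtain ⟨K', hK'⟩ := exists_abs_sub_le_of_one_le hq
    fun x hx => (h x hx).2
  have hA := asymptotic_const_nonneg hq hK'
  have h1 := sq_mul_pi_eq hq hK'
  rw [tsum_sqQuot_div hq] at h1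
  have h2 : (A / 2) ^ 2 = landauConst q ^ 2 := by
    rw [landauConst_sq hq, ← h1]
    have := Real.pi_ne_zero
    field_simp
    norm_num
  have h3 : A / 2 = landauConst q :=
    (sq_eq_sq₀ (by positivity) (landauConst_nonneg q)).1 h2
  rw [← h3]
  exact (h x hx).1

theorem abs_sum_evenInd_sub_le {q : ℕ} (hq : q = 3 ∨ q = 4) {x : ℝ} (hx : 2 ≤ x) :
    |∑ n ∈ Ioc 0 ⌊x⌋₊, evenInd q n - landauConst q * (x / √(Real.log x))| ≤
      8.53 * (x / Real.log x) := by
  rcases le_total (Real.exp 12.5) x with h | h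
  · exact abs_sum_evenInd_sub_le_of_exp_le hq h
  have hx0 : 0 < x := by linarith
  have hL0 : 0 < Real.log x := Real.log_pos (by linarith)
  have hL1 : Real.log x ≤ 12.5 := (Real.log_le_iff_le_exp hx0).2 h
  have h1 := sum_evenInd_nonneg hq ⌊x⌋₊
  have h2 := sum_evenInd_floor_le_self hq hx0.le
  have h3 := sum_evenInd_floor_le hq hx0.le
  have hC0 := landauConst_nonneg q
  have hC1 := landauConst_le_one (q := q)
  have hC2 := half_le_landauConst q
  -- For `log x ≤ 8` the bound `B(x) ≤ x` suffices. Beyond that `x ≥ 100` gives `B(x) ≤ 0.76 x`, and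
  -- `0.76 · 12.5 ≤ 8.53 + 1`, where the main term supplies the `1`.
  have hlog : Real.log x ≤ 8 ∨ 8 ≤ Real.log x ∧ 100 ≤ x := by
    rcases le_total (Real.log x) 8 with h4 | h4
    · exact Or.inl h4
    · refine Or.inr ⟨h4, le_trans ?_ ((Real.le_log_iff_exp_le hx0).1 h4)⟩
      rw [show (8 : ℝ) = (8 : ℕ) * 1 by norm_num, Real.exp_nat_mul]
      have h5 : (2 : ℝ) ≤ Real.exp 1 := by linarith [Real.exp_one_gt_d9]
      exact le_trans (by norm_num) (pow_le_pow_left₀ (by norm_num) h5 8)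
  generalize (∑ n ∈ Ioc 0 ⌊x⌋₊, evenInd q n) = β at *
  generalize landauConst q = C at *
  generalize Real.log x = L at *
  have hs : √L * √L = L := Real.mul_self_sqrt hL0.le
  have hs0 : 0 < √L := Real.sqrt_pos.2 hL0
  have hs1 : √L ≤ 8.53 := by nlinarith
  have e : C * (x / √L) = x / L * (C * √L) := by
    nth_rw 2 [← hs]
    field_simp
  have hu : 0 < x / L := by positivity
  have hβ : β ≤ C * (x / √L) + 8.53 * (x / L) := by
    rw [e, ← mul_comm (x / L), ← mul_add, div_mul_eq_mul_div, le_div_iff₀ hL0]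
    have h7 : 0 ≤ C * √L := by positivity
    rcases hlog with h4 | ⟨h4, h5⟩
    · nlinarith
    · have h8 : 2 ≤ √L := by nlinarith
      have h9 : 1 ≤ C * √L := by nlinarith
      have h10 : β * L ≤ (0.76 * x) * L := mul_le_mul_of_nonneg_right (by linarith) hL0.le
      nlinarith
  have h5 : C * (x / √L) ≤ 8.53 * (x / L) := by
    rw [e, mul_comm (x / L)]
    refine mul_le_mul_of_nonneg_right ?_ hu.le
    nlinarith
  have h6 : 0 ≤ C * (x / √L) := by positivity
  rw [abs_le]
  constructor <;> linarith

/-! ### Integers represented by the two forms -/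

theorem sq_add_sq_int_iff (n : ℕ) :
    (∃ X Y : ℤ, (n : ℤ) = X ^ 2 + ((1 : ℕ) : ℤ) * Y ^ 2) ↔ ∃ x y : ℕ, n = x ^ 2 + y ^ 2 := by
  constructor
  · rintro ⟨X, Y, h⟩
    refine ⟨X.natAbs, Y.natAbs, ?_⟩
    zify
    rw [h, sq_abs, sq_abs]
    simp
  · rintro ⟨x, y, h⟩
    refine ⟨x, y, ?_⟩
    rw [h]
    push_cast
    ring

theorem b_one_eq {n : ℕ} (hn : n ≠ 0) : b 1 n = evenInd 4 n := by
  classical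
  rw [evenInd_eq (Or.inr rfl) hn, b]
  refine if_congr ?_ rfl rfl
  rw [sq_add_sq_int_iff, Nat.eq_sq_add_sq_iff]
  refine forall₂_congr fun p hp => ?_
  rw [Nat.factorization_def _ (Nat.prime_of_mem_primeFactors hp)]

/-- The natural numbers represented by `X ^ 2 + 3 * Y ^ 2`. -/
def IsSqAddThreeSq (n : ℕ) : Prop := ∃ X Y : ℤ, (n : ℤ) = X ^ 2 + 3 * Y ^ 2

namespace IsSqAddThreeSq

theorem mul {m n : ℕ} (hm : IsSqAddThreeSq m) (hn : IsSqAddThreeSq n) :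
    IsSqAddThreeSq (m * n) := by
  obtain ⟨X, Y, hm⟩ := hm
  obtain ⟨Z, W, hn⟩ := hn
  refine ⟨X * Z + 3 * Y * W, X * W - Y * Z, ?_⟩
  push_cast
  rw [hm, hn]
  ring

theorem sq (n : ℕ) : IsSqAddThreeSq (n ^ 2) := ⟨n, 0, by push_cast; ring⟩

theorem three : IsSqAddThreeSq 3 := ⟨0, 1, by norm_num⟩

end IsSqAddThreeSq

/-- Otherwise `X/Y` is a square root of `-3` modulo `p`, and `(-1 + X/Y)/2` is a cube root of unity.
Since `p - 1 ≡ 1 mod 3`, Fermat's theorem forces it to be `1`, so `3 = 0` modulo `p`. -/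
theorem dvd_of_dvd_sq_add_three_mul_sq {p : ℕ} (hp : p.Prime) (hp3 : p % 3 = 2) (hp2 : p ≠ 2)
    {X Y : ℤ} (h : (p : ℤ) ∣ X ^ 2 + 3 * Y ^ 2) : (p : ℤ) ∣ X ∧ (p : ℤ) ∣ Y := by
  have := Fact.mk hp
  have h2 : (2 : ZMod p) ≠ 0 := by
    intro h2
    have : ((2 : ℕ) : ZMod p) = 0 := by exact_mod_cast h2
    rw [ZMod.natCast_eq_zero_iff] at this
    exact hp2 ((Nat.prime_dvd_prime_iff_eq hp Nat.prime_two).1 this)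
  have h3 : (3 : ZMod p) ≠ 0 := by
    intro h3
    have : ((3 : ℕ) : ZMod p) = 0 := by exact_mod_cast h3
    rw [ZMod.natCast_eq_zero_iff] at this
    have := (Nat.prime_dvd_prime_iff_eq hp Nat.prime_three).1 this
    omega
  simp only [← ZMod.intCast_zmod_eq_zero_iff_dvd] at h ⊢
  push_cast at h
  have hY : (Y : ZMod p) = 0 := by
    by_contra hY
    set z : ZMod p := X / Y with hz
    have hz2 : z ^ 2 = -3 := by
      rw [hz, div_pow, div_eq_iff (pow_ne_zero _ hY)]
      linear_combination h
    set w : ZMod p := (-1 + z) / 2 with hw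
    have hw1 : 2 * w = -1 + z := by
      rw [hw]
      field_simp
    have hw2 : w ^ 2 + w + 1 = 0 := by
      have : (2 * 2) * (w ^ 2 + w + 1) = 0 := by
        linear_combination (2 * w + 1 + z) * hw1 + hz2
      simpa [h2] using this
    have hw3 : w ^ 3 = 1 := by linear_combination (w - 1) * hw2
    have hw0 : w ≠ 0 := by
      rintro h0
      rw [h0] at hw3
      norm_num at hw3
    have hw4 := ZMod.pow_card_sub_one_eq_one hw0
    have hexp : p - 1 = 3 * (p / 3) + 1 := by omega
    rw [hexp, pow_succ, pow_mul, hw3, one_pow, one_mul] at hw4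
    rw [hw4] at hw2
    exact h3 (by linear_combination hw2)
  refine ⟨?_, hY⟩
  rw [hY] at h
  simpa using h

theorem IsSqAddThreeSq.exists_eq_sq_mul {p : ℕ} (hp : p.Prime) (hp3 : p % 3 = 2) {n : ℕ}
    (hpn : p ∣ n) (h : IsSqAddThreeSq n) : ∃ m, n = p ^ 2 * m ∧ IsSqAddThreeSq m := by
  obtain ⟨X, Y, h⟩ := h
  suffices ∃ U V : ℤ, X ^ 2 + 3 * Y ^ 2 = p ^ 2 * (U ^ 2 + 3 * V ^ 2) by
    obtain ⟨U, V, hUV⟩ := this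
    refine ⟨(U ^ 2 + 3 * V ^ 2).toNat, ?_, U, V, Int.toNat_of_nonneg (by positivity)⟩
    zify
    rw [Int.toNat_of_nonneg (by positivity), h, hUV]
  have hd : (p : ℤ) ∣ X ^ 2 + 3 * Y ^ 2 := by
    rw [← h]
    exact_mod_cast hpn
  by_cases hboth : (p : ℤ) ∣ X ∧ (p : ℤ) ∣ Y
  · obtain ⟨⟨U, rfl⟩, ⟨V, rfl⟩⟩ := hboth
    exact ⟨U, V, by ring⟩
  by_cases hp2 : p = 2
  · subst hp2
    have hpar : X % 2 = 1 ∧ Y % 2 = 1 := by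
      rw [Nat.cast_ofNat, ← even_iff_two_dvd] at hd
      norm_num at hboth
      have hXY : Even X ↔ Even Y := by
        have := hd
        rw [Int.even_add, Int.even_mul, Int.even_pow' two_ne_zero, Int.even_pow' two_ne_zero] at this
        have h3 : ¬ Even (3 : ℤ) := by decide
        tauto
      rw [Int.even_iff, Int.even_iff] at hXY
      omega
    -- The prime `2` is special: `4 = 1 + 3` is represented with both coordinates odd. After a
    -- choice of sign `X = ±Y + 4V`, and the form becomes `4((±Y + V)² + 3V²)`.
    have h4 : 4 ∣ X - Y ∨ 4 ∣ X + Y := by omega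
    rcases h4 with ⟨V, hV⟩ | ⟨V, hV⟩
    · refine ⟨Y + V, V, ?_⟩
      have : X = Y + 4 * V := by linarith
      rw [this]
      push_cast
      ring
    · refine ⟨-Y + V, V, ?_⟩
      have : X = -Y + 4 * V := by linarith
      rw [this]
      push_cast
      ring
  · exact absurd (dvd_of_dvd_sq_add_three_mul_sq hp hp3 hp2 hd) hboth

theorem IsSqAddThreeSq.even_factorization {p : ℕ} (hp : p.Prime) (hp3 : p % 3 = 2) {n : ℕ}
    (hn : n ≠ 0) (h : IsSqAddThreeSq n) : Even (n.factorization p) := by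
  induction n using Nat.strong_induction_on with
  | _ n ih =>
    by_cases hpn : p ∣ n
    · obtain ⟨m, rfl, hm⟩ := h.exists_eq_sq_mul hp hp3 hpn
      have hm0 : m ≠ 0 := right_ne_zero_of_mul hn
      have hlt : m < p ^ 2 * m :=
        lt_mul_of_one_lt_left (Nat.pos_of_ne_zero hm0) (Nat.one_lt_pow two_ne_zero hp.one_lt)
      rw [Nat.factorization_mul (pow_ne_zero _ hp.ne_zero) hm0, hp.factorization_pow]
      simpa [Nat.even_add] using ih m hlt hm0 hm
    · rw [Nat.factorization_eq_zero_of_not_dvd hpn]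
      exact Even.zero

/-- Since `3` divides `p - 1`, Cauchy's theorem gives a unit `w` of order `3`, and `(2w + 1)² = -3`.
-/
theorem exists_sq_add_three_eq_zero {p : ℕ} [Fact p.Prime] (hp1 : p % 3 = 1) :
    ∃ z : ZMod p, z ^ 2 + 3 = 0 := by
  have hp := (Fact.out : p.Prime)
  have : Fact (Nat.Prime 3) := ⟨Nat.prime_three⟩
  obtain ⟨w, hw⟩ := exists_prime_orderOf_dvd_card (G := (ZMod p)ˣ) 3 (by
    rw [ZMod.card_units_eq_totient, Nat.totient_prime hp]
    omega)
  have hw3 : (w : ZMod p) ^ 3 = 1 := by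
    rw [← Units.val_pow_eq_pow_val, ← hw, pow_orderOf_eq_one, Units.val_one]
  have hw1 : (w : ZMod p) - 1 ≠ 0 := by
    intro h
    have : w = 1 := Units.ext (sub_eq_zero.1 h)
    rw [this, orderOf_one] at hw
    norm_num at hw
  refine ⟨2 * w + 1, ?_⟩
  have h : ((w : ZMod p) - 1) * ((2 * w + 1) ^ 2 + 3) = 0 := by linear_combination 4 * hw3
  exact (mul_eq_zero.1 h).resolve_left hw1

/-- Thue's argument: with `z² = -3`, two of the more than `p` pairs in a box of side `⌊√p⌋` have
equal `u - z v`. Their difference satisfies `x² + 3y² = m p` with `0 < m < 4`. -/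
theorem isSqAddThreeSq_of_prime {p : ℕ} (hp : p.Prime) (hp1 : p % 3 = 1) : IsSqAddThreeSq p := by
  have := Fact.mk hp
  obtain ⟨z, hz⟩ := exists_sq_add_three_eq_zero hp1
  set k := Nat.sqrt p with hk
  have hcard : #(univ : Finset (ZMod p)) < #(range (k + 1) ×ˢ range (k + 1)) := by
    rw [card_univ, ZMod.card, card_product, card_range]
    exact Nat.lt_succ_sqrt p
  obtain ⟨⟨u, v⟩, huv, ⟨u', v'⟩, huv', hne, heq⟩ := exists_ne_map_eq_of_card_lt_of_maps_to hcard
    (f := fun x : ℕ × ℕ => (x.1 : ZMod p) - z * x.2) fun _ _ => mem_coe.2 (mem_univ _)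
  simp only [mem_product, mem_range] at huv huv' heq
  obtain ⟨x, hx⟩ : ∃ x : ℤ, x = u - u' := ⟨_, rfl⟩
  obtain ⟨y, hy⟩ : ∃ y : ℤ, y = v - v' := ⟨_, rfl⟩
  have hksq : k * k < p := by
    refine lt_of_le_of_ne (Nat.sqrt_le p) fun h => ?_
    exact Nat.prime_mul_iff.1 (h ▸ hp) |>.elim (fun h' => hp.ne_one (by simpa [h'.2] using h.symm))
      fun h' => hp.ne_one (by simpa [h'.2] using h.symm)
  have hx2 : x ^ 2 ≤ k ^ 2 := sq_le_sq' (by omega) (by omega)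
  have hy2 : y ^ 2 ≤ k ^ 2 := sq_le_sq' (by omega) (by omega)
  have hdvd : (p : ℤ) ∣ x ^ 2 + 3 * y ^ 2 := by
    rw [← ZMod.intCast_zmod_eq_zero_iff_dvd, hx, hy]
    push_cast
    have h1 : (u : ZMod p) - u' = z * (v - v') := by linear_combination heq
    rw [h1]
    linear_combination ((v : ZMod p) - v') ^ 2 * hz
  have hpos : 0 < x ^ 2 + 3 * y ^ 2 := by
    by_contra! h
    have hx0 : x = 0 := by nlinarith [sq_nonneg x, sq_nonneg y]
    have hy0 : y = 0 := by nlinarith [sq_nonneg x, sq_nonneg y]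
    exact hne (Prod.ext (by simp only; omega) (by simp only; omega))
  obtain ⟨m, hm⟩ := hdvd
  have hp0 : (0 : ℤ) < p := by exact_mod_cast hp.pos
  have hksq' : (k : ℤ) ^ 2 < p := by
    rw [pow_two]
    exact_mod_cast hksq
  have hm0 : 0 < m := by
    rw [hm] at hpos
    nlinarith
  have hm4 : m < 4 := by
    by_contra! h
    nlinarith
  have hodd : (p : ℤ) % 2 = 1 := by
    rcases hp.eq_two_or_odd with h | h
    · omega
    · omega
  interval_cases m
  · exact ⟨x, y, by linarith⟩
  -- `m = 2` is impossible: `x² + 3y²` is never `2` modulo `4`, while `2p` is, `p` being odd.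
  · exfalso
    have h1 : x ^ 2 % 4 = 0 ∨ x ^ 2 % 4 = 1 := by
      rcases Int.even_or_odd' x with ⟨c, rfl | rfl⟩
      · left; ring_nf; omega
      · right; ring_nf; omega
    have h2 : y ^ 2 % 4 = 0 ∨ y ^ 2 % 4 = 1 := by
      rcases Int.even_or_odd' y with ⟨c, rfl | rfl⟩
      · left; ring_nf; omega
      · right; ring_nf; omega
    omega
  -- For `m = 3` the number `x` is divisible by `3`; writing `x = 3w` gives `p = y² + 3w²`.
  · have h3 : (3 : ℤ) ∣ x ^ 2 := by omega
    obtain ⟨w, rfl⟩ := Int.prime_three.dvd_of_dvd_pow h3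
    exact ⟨y, w, by linarith⟩

theorem isSqAddThreeSq_of_even_factorization {n : ℕ} (hn : n ≠ 0)
    (h : ∀ p : ℕ, p.Prime → p % 3 = 2 → Even (n.factorization p)) : IsSqAddThreeSq n := by
  induction n using Nat.strong_induction_on with
  | _ n ih =>
    by_cases h1 : n = 1
    · exact ⟨1, 0, by simp [h1]⟩
    obtain ⟨p, hp, m, rfl⟩ := Nat.exists_prime_and_dvd h1
    have hm0 : m ≠ 0 := right_ne_zero_of_mul hn
    by_cases hp3 : p % 3 = 2
    · have h2 := h p hp hp3
      rw [Nat.factorization_mul hp.ne_zero hm0, Finsupp.add_apply, hp.factorization_self] at h2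
      have hpm : p ∣ m := by
        by_contra hpm
        rw [Nat.factorization_eq_zero_of_not_dvd hpm] at h2
        exact absurd h2 (by decide)
      obtain ⟨l, rfl⟩ := hpm
      have hl0 : l ≠ 0 := right_ne_zero_of_mul hm0
      rw [← mul_assoc, ← pow_two] at h ⊢
      refine (IsSqAddThreeSq.sq p).mul (ih l ?_ hl0 fun r hr hr3 => ?_)
      · rw [← mul_assoc, ← pow_two]
        exact lt_mul_of_one_lt_left (Nat.pos_of_ne_zero hl0)
          (Nat.one_lt_pow two_ne_zero hp.one_lt)
      · have h4 := h r hr hr3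
        rw [Nat.factorization_mul (pow_ne_zero _ hp.ne_zero) hl0, Nat.factorization_pow] at h4
        simpa [Nat.even_add] using h4
    · have hrep : IsSqAddThreeSq p := by
        by_cases hp1 : p % 3 = 1
        · exact isSqAddThreeSq_of_prime hp hp1
        · have : 3 ∣ p := by omega
          rw [← (Nat.prime_dvd_prime_iff_eq Nat.prime_three hp).1 this]
          exact IsSqAddThreeSq.three
      refine hrep.mul (ih m (lt_mul_of_one_lt_left (Nat.pos_of_ne_zero hm0) hp.one_lt) hm0
        fun r hr hr3 => ?_)
      have h4 := h r hr hr3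
      have hpr : p ≠ r := by
        rintro rfl
        exact hp3 hr3
      rwa [Nat.factorization_mul hp.ne_zero hm0, Finsupp.add_apply, hp.factorization,
        Finsupp.single_eq_of_ne hpr.symm, zero_add] at h4

theorem b_three_eq {n : ℕ} (hn : n ≠ 0) : b 3 n = evenInd 3 n := by
  classical
  rw [evenInd_eq (Or.inl rfl) hn, b]
  refine if_congr ?_ rfl rfl
  constructor
  · intro h p hp hp3
    exact IsSqAddThreeSq.even_factorization (Nat.prime_of_mem_primeFactors hp) hp3 hn h
  · intro h
    refine isSqAddThreeSq_of_even_factorization hn fun p hp hp3 => ?_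
    by_cases hpn : p ∈ n.primeFactors
    · exact h p hpn hp3
    · rw [← Nat.support_factorization, Finsupp.notMem_support_iff] at hpn
      rw [hpn]
      exact Even.zero

theorem B_one_eq (x : ℝ) : B 1 x = ∑ n ∈ Ioc 0 ⌊x⌋₊, evenInd 4 n :=
  sum_congr rfl fun _ hn => b_one_eq (mem_Ioc.1 hn).1.ne'

theorem B_three_eq (x : ℝ) : B 3 x = ∑ n ∈ Ioc 0 ⌊x⌋₊, evenInd 3 n :=
  sum_congr rfl fun _ hn => b_three_eq (mem_Ioc.1 hn).1.ne'

theorem landauConst_four : landauConst 4 = C₁ := by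
  rw [landauConst, if_neg (by norm_num), mul_one]
  rfl

theorem landauConst_three : landauConst 3 = C₃ := by
  rw [landauConst, if_pos rfl]
  rfl

end LandauRamanujan

theorem lemma9 :
    (∀ x : ℝ, 2 ≤ x →
      |LandauRamanujan.B 1 x - LandauRamanujan.C₁ * (x / √(Real.log x))|
        ≤ 9.62 * (x / Real.log x)) ∧
    (∀ x : ℝ, 2 ≤ x →
      |LandauRamanujan.B 3 x - LandauRamanujan.C₃ * (x / √(Real.log x))|
        ≤ 8.53 * (x / Real.log x)) := by
  refine ⟨fun x hx => ?_, fun x hx => ?_⟩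
  · have h := LandauRamanujan.abs_sum_evenInd_sub_le (Or.inr rfl) hx
    rw [← LandauRamanujan.B_one_eq, LandauRamanujan.landauConst_four] at h
    -- The argument gives `8.53` for both forms; nonnegativity of `x / log x` relaxes it to `9.62`.
    have hpos : 0 ≤ x / Real.log x :=
      div_nonneg (by linarith) (Real.log_nonneg (by linarith))
    linarith
  · have h := LandauRamanujan.abs_sum_evenInd_sub_le (Or.inl rfl) hx
    rwa [← LandauRamanujan.B_three_eq, LandauRamanujan.landauConst_three] at h
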